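/- We work in second order arithmetic. A structure $(N,S)$ for its language consists of a set $N$ with interpretations of $0,1,+,\cdot,<$ and a nonempty collection $S$ of subsets of $N$; number and set quantifiers range over $N$ and $S$. The theory $\mathsf{ATR_0}$ consists of the basic axioms of arithmetic, the induction axiom for sets, comprehension for arithmetical formulas with parameters, and arithmetical transfinite recursion along arbitrary well orders. All notions below are interpreted in such a structure: sets, relations and functions are members of $S$ (via pairing of numbers), finite sets are coded by numbers, and well-foundedness means that each nonempty set in $S$ has a minimal element. For an infinite set $V\subseteq\mathbb N$, let $[V]^\omega$ be the collection of its infinite subsets. For finite $s$, write $s\sqsubset X$ if $s$ is an initial segment of $X\in[V]^\omega$, and let $X^-$ be $X$ without its least element. A block with base $V$ is a set $B$ of nonempty finite subsets of $V$ such that each $X\in[V]^\omega$ has a unique initial segment in $B$. A $Q$-array $f:[V]^\omega\to Q$ is given by a function $f_0:B\to Q$ on a block $B$ with base $V$, where $f(X)=f_0(s)$ for the $s\in B$ with $s\sqsubset X$. Let $R$ be a reflexive binary relation on a set $Q$. * A $Q$-array $f:[V]^\omega\to Q$ is $R$-bad if there is no $X\in[V]^\omega$ with $f(X)\,R\,f(X^-)$.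 The relation $R$ is better if there is no $R$-bad $Q$-array. * A partial ranking of $R$ is a well-founded partial order $\leq'$ on $Q$ such that $p\,R\,q$ and $q\leq' r$ entail $p\,R\,r$. * For $Q$-arrays $f:[V]^\omega\to Q$ and $g:[W]^\omega\to Q$, we write $f\leq' g$ (resp. $f<'g$) if $V\subseteq W$ and $f(X)\leq' g(X)$ (resp. $f(X)<'g(X)$) for all $X\in[V]^\omega$. A $Q$-array $g$ is $\leq'$-minimal $R$-bad if it is $R$-bad and there is no $R$-bad $Q$-array $f<'g$. Simpson's minimal bad array lemma for quasi orders is the following statement: for any quasi order $\leq_Q$ on a set $Q$, any partial ranking $\leq'$ of $\leq_Q$ and any $\leq_Q$-bad $Q$-array $f_0$, there is a $Q$-array $f\leq' f_0$ that is $\leq'$-minimal $\leq_Q$-bad. **Corollary.** $\mathsf{ATR_0}$ proves (equivalently, every structure $(N,S)$ that is a model of $\mathsf{ATR_0}$ satisfies) the following: if Simpson's minimal bad array lemma for quasi orders holds, then for any reflexive binary relation $R$ on a set $Q$ and any partial ranking $\leq'$ of $R$ such that $R$ is not a better relation on $Q$, there is a $Q$-array that is $\leq'$-minimal $R$-bad.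 -/

import Mathlib

/-! ### The language of second order arithmetic and its (Henkin) structures

A structure for second order arithmetic is a nonempty collection `S` of subsets of a type `N` that
carries the arithmetical signature. Number quantifiers range over `N`, set quantifiers over `S`.
Neither is assumed to be standard: `N` may differ from `ℕ`, and `S` need not be the full
power set. -/

/-- The arithmetical signature `0, 1, +, ·, <` of second order arithmetic, without any axioms. -/
class ArithSignature (N : Type*) extends Zero N, One N, Add N, Mul N, LT N

/-- Numerical terms; number variables are indexed by `ℕ`. -/
inductive NumTerm : Type
  | var (i : ℕ) : NumTerm
  | zero : NumTerm
  | one : NumTerm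
  | add (s t : NumTerm) : NumTerm
  | mul (s t : NumTerm) : NumTerm

/-- Arithmetical formulas: formulas of second order arithmetic without set quantifiers. Set
variables (indexed by `ℕ`) may occur free, as parameters. -/
inductive ArithFormula : Type
  | eq (s t : NumTerm) : ArithFormula
  | lt (s t : NumTerm) : ArithFormula
  | mem (t : NumTerm) (i : ℕ) : ArithFormula
  | neg (φ : ArithFormula) : ArithFormula
  | and (φ ψ : ArithFormula) : ArithFormula
  | all (i : ℕ) (φ : ArithFormula) : ArithFormula

section SecondOrderArithmetic

variable {N : Type*} [ArithSignature N]

/-- The value of a term when number variables are interpreted by `e`. -/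
def NumTerm.val (e : ℕ → N) : NumTerm → N
  | .var i => e i
  | .zero => 0
  | .one => 1
  | .add s t => s.val e + t.val e
  | .mul s t => s.val e * t.val e

/-- Satisfaction of arithmetical formulas when number variables are interpreted by `e` and set
variables by `E`. -/
def ArithFormula.Sat (e : ℕ → N) (E : ℕ → Set N) : ArithFormula → Prop
  | .eq s t => s.val e = t.val e
  | .lt s t => s.val e < t.val e
  | .mem t i => t.val e ∈ E i
  | .neg φ => ¬ φ.Sat e E
  | .and φ ψ => φ.Sat e E ∧ ψ.Sat e E
  | .all i φ => ∀ x : N, φ.Sat (Function.update e i x) E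

/-! ### Coding of pairs and finite sets by numbers -/

/-- The pairing `(m, n) = (m + n)² + m`. -/
def pairCode (m n : N) : N := (m + n) * (m + n) + m

/-- `x` is an element of the finite set with code `c = (k, (m, n))`, which consists of all `x < k`
such that `m(x + 1) + 1` divides `n`. Numbers that are not of this form represent `∅`. -/
def CodeElem (x c : N) : Prop :=
  ∃ k m n : N, c = pairCode k (pairCode m n) ∧ x < k ∧ ∃ d : N, n = (m * (x + 1) + 1) * d

/-- `c` is the code of a finite set, namely the least number that represents this set. Thus
each finite set has exactly one code. -/
def IsFiniteCode (c : N) : Prop :=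
  ∀ c' : N, c' < c → ¬ ∀ x : N, CodeElem x c' ↔ CodeElem x c

/-! ### Binary relations, coded as sets of pairs -/

/-- `R` is a binary relation on `Q`, that is, `R ⊆ Q × Q`. -/
def IsRelationOn (Q R : Set N) : Prop :=
  ∀ k ∈ R, ∃ p ∈ Q, ∃ q ∈ Q, k = pairCode p q

/-- `R` is reflexive on `Q`. -/
def IsReflexiveOn (Q R : Set N) : Prop :=
  ∀ q ∈ Q, pairCode q q ∈ R

/-- `R` is transitive. -/
def IsTransitiveRel (R : Set N) : Prop :=
  ∀ p q r : N, pairCode p q ∈ R → pairCode q r ∈ R → pairCode p r ∈ R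

/-- `R` is antisymmetric. -/
def IsAntisymmRel (R : Set N) : Prop :=
  ∀ p q : N, pairCode p q ∈ R → pairCode q p ∈ R → p = q

/-- `R` is a quasi order on `Q`. -/
def IsQuasiOrderOn (Q R : Set N) : Prop :=
  IsRelationOn Q R ∧ IsReflexiveOn Q R ∧ IsTransitiveRel R

/-- `R` is a partial order on `Q`. -/
def IsPartialOrderOn (Q R : Set N) : Prop :=
  IsRelationOn Q R ∧ IsReflexiveOn Q R ∧ IsTransitiveRel R ∧ IsAntisymmRel R

/-- `p <_L q` for a partial order `L`. -/
def StrictlyBelow (L : Set N) (p q : N) : Prop := pairCode p q ∈ L ∧ p ≠ q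

/-- The order `L` on `Q` is well-founded in the sense of the structure `S`: each nonempty
subset of `Q` in `S` has an `L`-minimal element. -/
def IsWellFoundedOn (S : Set (Set N)) (Q L : Set N) : Prop :=
  ∀ Z ∈ S, Z ⊆ Q → Z.Nonempty → ∃ m ∈ Z, ∀ z ∈ Z, ¬ StrictlyBelow L z m

/-! ### The theory ATR₀ -/

/-- `L` is a well order on `A`, in the sense of the structure `S`. -/
def IsWellOrderOn (S : Set (Set N)) (A L : Set N) : Prop :=
  IsPartialOrderOn A L ∧ (∀ i ∈ A, ∀ j ∈ A, pairCode i j ∈ L ∨ pairCode j i ∈ L) ∧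
    IsWellFoundedOn S A L

/-- The part `{(m, i) ∈ Y | i <_L j}` of a hierarchy `Y` along `L` that lies below stage `j`. -/
def hierarchyBelow (L Y : Set N) (j : N) : Set N :=
  {k | k ∈ Y ∧ ∃ m i : N, k = pairCode m i ∧ StrictlyBelow L i j}

/-- `(N, S)` is a model of ACA₀: basic axioms, the induction axiom and arithmetical comprehension
(with arbitrary number and set parameters). -/
structure ModelsACA0 (S : Set (Set N)) : Prop where
  sets_nonempty : S.Nonempty
  succ_ne_zero : ∀ m : N, m + 1 ≠ 0
  succ_inj : ∀ m n : N, m + 1 = n + 1 → m = n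
  add_zero : ∀ m : N, m + 0 = m
  add_succ : ∀ m n : N, m + (n + 1) = (m + n) + 1
  mul_zero : ∀ m : N, m * 0 = 0
  mul_succ : ∀ m n : N, m * (n + 1) = m * n + m
  not_lt_zero : ∀ m : N, ¬ m < 0
  lt_succ : ∀ m n : N, m < n + 1 ↔ m < n ∨ m = n
  induction : ∀ X ∈ S, (0 : N) ∈ X → (∀ n : N, n ∈ X → n + 1 ∈ X) → ∀ n : N, n ∈ X
  comprehension : ∀ (φ : ArithFormula) (e : ℕ → N) (E : ℕ → Set N), (∀ i, E i ∈ S) →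
    {n : N | φ.Sat (Function.update e 0 n) E} ∈ S

/-- `(N, S)` is a model of ATR₀: in addition to ACA₀, arithmetical comprehension can be iterated
along any well order. For an arithmetical formula `θ(n, X)` with parameters, there is a `Y` with
`Y = {(n, j) | j ∈ A and θ(n, Y^j)}` where `Y^j` is the part of `Y` below stage `j`. -/
structure ModelsATR0 (S : Set (Set N)) : Prop extends ModelsACA0 S where
  transfinite_recursion : ∀ (θ : ArithFormula) (e : ℕ → N) (E : ℕ → Set N), (∀ i, E i ∈ S) →
    ∀ A ∈ S, ∀ L ∈ S, IsWellOrderOn S A L →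
      ∃ Y ∈ S, ∀ k : N, k ∈ Y ↔ ∃ n j : N, k = pairCode n j ∧ j ∈ A ∧
        θ.Sat (Function.update e 0 n) (Function.update E 0 (hierarchyBelow L Y j))

/-! ### Blocks, arrays and better relations -/

/-- `X ∈ [V]^ω`, in the sense of the structure `S`. -/
def IsInfiniteSubset (S : Set (Set N)) (V X : Set N) : Prop :=
  X ∈ S ∧ X ⊆ V ∧ ∀ n : N, ∃ x ∈ X, n < x

/-- The finite set with code `s` is an initial segment of the infinite set `X`. -/
def IsInitialSegment (s : N) (X : Set N) : Prop :=
  ∃ n : N, ∀ x : N, CodeElem x s ↔ x ∈ X ∧ x < n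

/-- The set `X⁻` that results from `X` when the least element is removed. -/
def removeMin (X : Set N) : Set N := {x | x ∈ X ∧ ∃ y ∈ X, y < x}

/-- `B` is (the set of codes for the elements of) a block with base `V`: a collection of nonempty
finite subsets of the infinite set `V` such that each `X ∈ [V]^ω` has a unique initial segment
in `B`. -/
def IsBlock (S : Set (Set N)) (V B : Set N) : Prop :=
  IsInfiniteSubset S V V ∧
  (∀ s ∈ B, IsFiniteCode s ∧ (∃ x : N, CodeElem x s) ∧ ∀ x : N, CodeElem x s → x ∈ V) ∧
  ∀ X : Set N, IsInfiniteSubset S V X → ∃! s : N, s ∈ B ∧ IsInitialSegment s X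

/-- `F` is (the graph of) a function from `B` to `Q`. -/
def IsFunctionFromTo (B Q F : Set N) : Prop :=
  (∀ k ∈ F, ∃ s ∈ B, ∃ q ∈ Q, k = pairCode s q) ∧ ∀ s ∈ B, ∃! q : N, pairCode s q ∈ F

/-- `F` represents a `Q`-array with domain `[V]^ω`: it is a function from some block with base `V`
to `Q`. -/
def IsArray (S : Set (Set N)) (Q V F : Set N) : Prop :=
  V ∈ S ∧ F ∈ S ∧ ∃ B ∈ S, IsBlock S V B ∧ IsFunctionFromTo B Q F

/-- `f(X) = q` for the array `f` represented by `F`: we have `F(s) = q` for some `s ⊏ X`. -/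
def ArrayValue (F X : Set N) (q : N) : Prop :=
  ∃ s : N, IsInitialSegment s X ∧ pairCode s q ∈ F

/-- `F` represents an `R`-bad `Q`-array with domain `[V]^ω`: there is no `X ∈ [V]^ω` such that
`f(X) R f(X⁻)`. -/
def IsBadArray (S : Set (Set N)) (Q R V F : Set N) : Prop :=
  IsArray S Q V F ∧
  ¬ ∃ X : Set N, IsInfiniteSubset S V X ∧
    ∃ p q : N, ArrayValue F X p ∧ ArrayValue F (removeMin X) q ∧ pairCode p q ∈ R

/-- `R` is a better relation on `Q`: no `Q`-array is `R`-bad. -/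
def IsBetterRelation (S : Set (Set N)) (Q R : Set N) : Prop :=
  ¬ ∃ V F : Set N, IsBadArray S Q R V F

/-! ### Partial rankings and minimal bad arrays -/

/-- `L` is a partial ranking of the relation `R` on `Q`: a well-founded partial order on `Q` such
that `p R q` and `q ≤' r` entail `p R r`. -/
def IsPartialRanking (S : Set (Set N)) (Q R L : Set N) : Prop :=
  IsPartialOrderOn Q L ∧ IsWellFoundedOn S Q L ∧
  ∀ p q r : N, pairCode p q ∈ R → pairCode q r ∈ L → pairCode p r ∈ R

/-- `f ≤' g` for arrays `f : [V]^ω → Q` and `g : [W]^ω → Q` represented by `F` and `G`. -/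
def ArrayLE (S : Set (Set N)) (L V F W G : Set N) : Prop :=
  V ⊆ W ∧ ∀ X : Set N, IsInfiniteSubset S V X →
    ∀ p q : N, ArrayValue F X p → ArrayValue G X q → pairCode p q ∈ L

/-- `f <' g` for arrays `f : [V]^ω → Q` and `g : [W]^ω → Q` represented by `F` and `G`. -/
def ArrayLT (S : Set (Set N)) (L V F W G : Set N) : Prop :=
  V ⊆ W ∧ ∀ X : Set N, IsInfiniteSubset S V X →
    ∀ p q : N, ArrayValue F X p → ArrayValue G X q → StrictlyBelow L p q

/-- `G` represents a `≤'`-minimal `R`-bad `Q`-array with domain `[W]^ω`: it is `R`-bad and there is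
no `R`-bad `Q`-array `f <' g`. -/
def IsMinimalBadArray (S : Set (Set N)) (Q R L W G : Set N) : Prop :=
  IsBadArray S Q R W G ∧
  ¬ ∃ V F : Set N, IsBadArray S Q R V F ∧ ArrayLT S L V F W G

/-- Simpson's version of the minimal bad array lemma for quasi orders, as a statement about the
structure `(N, S)`: for any quasi order `(Q, R)`, any partial ranking `≤'` of `R` and any `R`-bad
`Q`-array `f₀`, there is a `≤'`-minimal `R`-bad `Q`-array `f ≤' f₀`. -/
def SimpsonMinimalBadArrayLemma (S : Set (Set N)) : Prop :=
  ∀ Q ∈ S, ∀ R ∈ S, ∀ L ∈ S, IsQuasiOrderOn Q R → IsPartialRanking S Q R L →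
    ∀ V₀ F₀ : Set N, IsBadArray S Q R V₀ F₀ →
      ∃ V F : Set N, IsMinimalBadArray S Q R L V F ∧ ArrayLE S L V F V₀ F₀

end SecondOrderArithmetic

/-!
Minimal bad arrays for a reflexive relation `R` are obtained by applying the lemma for quasi orders
to a quasi order on a different set.

An element `p` of `Q` is tagged with a label `(a, b)`, where `a < b`, and with a finite set `E` of
"earlier values". For tagged elements `x = (a, b, E, p)` and `y = (c, d, E', q)`, the ranking puts
`x` strictly below `y` if the labels agree, `p <' q` and `E ⊇ E' ∪ {q}`. In the quasi order, `x` is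
below `y` if it is so in the ranking, or if `b = c` and some element of `E ∪ {p}` is `R`-related to
`q`, or if `b < c`. The labels make the relation transitive: if the comparisons of `x` with `y` and
of `y` with `z` are both of the last two kinds, then `b ≤ c < d ≤ g` for the label `(g, k)` of `z`, so
that `x` is below `z` without any condition on `R` (`ModelsACA0.taggedOrder_isQuasiOrderOn`). The
sets `E` take care of the comparisons that involve the ranking: `p ≤' q R r` need not entail `p R r`,
but it places `x` below `z` since `E` remembers `q`.

An `R`-bad array `f₀` gives rise to the bad array `X ↦ (x₀, x₁, ∅, f₀(X))`, where `x₀, x₁` are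
the first two elements of `X` (`ModelsACA0.exists_tagged_array`). A minimal bad array below it has
the same labels, because the ranking only compares elements with equal labels. The labels of `X` and
`X⁻` are `(x₀, x₁)` and `(x₁, x₂)`, and for such labels the quasi order reduces to `R`. Hence the
underlying `Q`-array `f` is `R`-bad. If `f₁ <' f` was `R`-bad, then `X ↦ (x₀, x₁, E ∪ {f(X)}, f₁(X))`
would contradict minimality: it is bad since `e R f₁(X⁻)` for an old value `e` entails `e R f(X⁻)`
(`ModelsACA0.exists_isMinimalBadArray`).

The argument only uses arithmetical comprehension. To apply it to predicates in Lean's syntax, the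
class `ArithPred` lets instance resolution check that a predicate is arithmetical. Finite
sets are coded via a version of Gödel's `β`-function (`ModelsACA0.exists_code`), and arrays are
combined pointwise on a common refinement of their blocks (`ModelsACA0.exists_combined_array`).
-/

/-! ### Arithmetical predicates and comprehension -/

section Definability

variable {N : Type*} [ArithSignature N]

/-- The term `t` with its variables renamed along `σ`. -/
def NumTerm.rename (σ : ℕ → ℕ) : NumTerm → NumTerm
  | .var i => .var (σ i)
  | .zero => .zero
  | .one => .one
  | .add s t => .add (s.rename σ) (t.rename σ)
  | .mul s t => .mul (s.rename σ) (t.rename σ)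

/-- The formula `φ` with its number variables (free and bound) renamed along `σ` and its set
variables renamed along `ρ`. -/
def ArithFormula.rename (σ ρ : ℕ → ℕ) : ArithFormula → ArithFormula
  | .eq s t => .eq (s.rename σ) (t.rename σ)
  | .lt s t => .lt (s.rename σ) (t.rename σ)
  | .mem t i => .mem (t.rename σ) (ρ i)
  | .neg φ => .neg (φ.rename σ ρ)
  | .and φ ψ => .and (φ.rename σ ρ) (ψ.rename σ ρ)
  | .all i φ => .all (σ i) (φ.rename σ ρ)

theorem NumTerm.val_rename (σ : ℕ → ℕ) (e : ℕ → N) (t : NumTerm) :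
    (t.rename σ).val e = t.val (e ∘ σ) := by
  induction t with
  | var i => rfl
  | zero => rfl
  | one => rfl
  | add s t hs ht => simp [NumTerm.rename, NumTerm.val, hs, ht]
  | mul s t hs ht => simp [NumTerm.rename, NumTerm.val, hs, ht]

theorem ArithFormula.sat_rename {σ : ℕ → ℕ} (hσ : σ.Injective) (ρ : ℕ → ℕ) (E : ℕ → Set N)
    (φ : ArithFormula) : ∀ e : ℕ → N, (φ.rename σ ρ).Sat e E ↔ φ.Sat (e ∘ σ) (E ∘ ρ) := by
  induction φ with
  | eq s t => simp [ArithFormula.rename, ArithFormula.Sat, NumTerm.val_rename]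
  | lt s t => simp [ArithFormula.rename, ArithFormula.Sat, NumTerm.val_rename]
  | mem t i => simp [ArithFormula.rename, ArithFormula.Sat, NumTerm.val_rename]
  | neg φ h => simp [ArithFormula.rename, ArithFormula.Sat, h]
  | and φ ψ h h' => simp [ArithFormula.rename, ArithFormula.Sat, h, h']
  | all i φ h =>
    intro e
    simp only [ArithFormula.rename, ArithFormula.Sat, h, Function.update_comp_eq_of_injective e hσ]

/-- The sequence `v 0, c 0, v 1, c 1, …`: even positions hold the values of variables, odd positions
hold parameters. -/
def interleave {α : Type*} (v c : ℕ → α) (k : ℕ) : α :=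
  if k % 2 = 0 then v (k / 2) else c (k / 2)

@[simp] theorem interleave_even {α : Type*} (v c : ℕ → α) (i : ℕ) :
    interleave v c (2 * i) = v i := by
  simp [interleave]

@[simp] theorem interleave_odd {α : Type*} (v c : ℕ → α) (i : ℕ) :
    interleave v c (2 * i + 1) = c i := by
  have h : (2 * i + 1) / 2 = i := by omega
  simp [interleave, Nat.add_mod, h]

@[elab_as_elim]
theorem forall_nat_parity {P : ℕ → Prop} (h0 : ∀ i, P (2 * i)) (h1 : ∀ i, P (2 * i + 1)) (k : ℕ) :
    P k := by
  obtain ⟨i, rfl | rfl⟩ := Nat.even_or_odd' k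
  exacts [h0 i, h1 i]

/-- Renaming that fixes the variables and moves the `i`-th parameter to the position of
parameter `2 * i + d`, which makes room for the parameters of a second formula. -/
def spreadParams (d : ℕ) : ℕ → ℕ := interleave (fun i => 2 * i) (fun i => 2 * (2 * i + d) + 1)

theorem spreadParams_injective (d : ℕ) : (spreadParams d).Injective := by
  intro a b
  refine forall_nat_parity (fun i => ?_) (fun i => ?_) a <;>
    refine forall_nat_parity (fun j => ?_) (fun j => ?_) b <;>
    simp only [spreadParams, interleave_even, interleave_odd] <;> omega

theorem interleave_comp_spreadParams_zero {α : Type*} (v c d : ℕ → α) :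
    interleave v (interleave c d) ∘ spreadParams 0 = interleave v c := by
  funext k
  refine forall_nat_parity (fun i => ?_) (fun i => ?_) k <;> simp [spreadParams]

theorem interleave_comp_spreadParams_one {α : Type*} (v c d : ℕ → α) :
    interleave v (interleave c d) ∘ spreadParams 1 = interleave v d := by
  funext k
  refine forall_nat_parity (fun i => ?_) (fun i => ?_) k <;> simp [spreadParams]

/-- Renaming for a quantifier over the first variable: that variable becomes the first parameter,
the other variables move down and the other parameters move up. -/
def bindFirst : ℕ → ℕ :=
  interleave (fun i => if i = 0 then 1 else 2 * (i - 1)) (fun i => 2 * (i + 1) + 1)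

theorem bindFirst_injective : bindFirst.Injective := by
  intro a b
  refine forall_nat_parity (fun i => ?_) (fun i => ?_) a <;>
    refine forall_nat_parity (fun j => ?_) (fun j => ?_) b <;>
    simp only [bindFirst, interleave_even, interleave_odd] <;> grind

/-- The sequence `a, v 0, v 1, …`. -/
def consSeq {α : Type*} (a : α) (v : ℕ → α) : ℕ → α
  | 0 => a
  | i + 1 => v i

theorem update_comp_bindFirst {α : Type*} (v c : ℕ → α) (a x : α) :
    Function.update (interleave v (consSeq x c)) 1 a ∘ bindFirst =
      interleave (consSeq a v) c := by
  funext k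
  refine forall_nat_parity (fun i => ?_) (fun i => ?_) k
  · rcases i with _ | i
    · simp [bindFirst, interleave, consSeq]
    · have h : 2 * i ≠ 1 := by omega
      simp only [bindFirst, interleave_even, Function.comp, Nat.add_sub_cancel, Nat.succ_ne_zero,
        if_false, Function.update_of_ne h, consSeq]
  · have h : 2 * (i + 1) + 1 ≠ 1 := by omega
    simp only [bindFirst, interleave_odd, Function.comp, Function.update_of_ne h,
      consSeq]

/-- The function `t` of the variables `v 0, v 1, …` is given by a numerical term with
parameters. -/
class ArithTerm (t : (ℕ → N) → N) : Prop where
  exists_term : ∃ (τ : NumTerm) (c : ℕ → N), ∀ v, τ.val (interleave v c) = t v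

/-- The predicate `P` of the variables `v 0, v 1, …` is arithmetical, with number parameters and with
set parameters from `S`. This is a class so that instance resolution can check that a predicate
is arithmetical by recursion over its syntax. -/
class ArithPred (S : Set (Set N)) (P : (ℕ → N) → Prop) : Prop where
  exists_formula : ∃ (φ : ArithFormula) (c : ℕ → N) (E : ℕ → Set N), (∀ i, E i ∈ S) ∧
    ∀ v, φ.Sat (interleave v c) E ↔ P v

instance ArithTerm.var (i : ℕ) : ArithTerm (fun v : ℕ → N => v i) :=
  ⟨.var (2 * i), fun _ => 0, fun v => by simp [NumTerm.val]⟩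

instance ArithTerm.const (a : N) : ArithTerm (fun _ : ℕ → N => a) :=
  ⟨.var (2 * 0 + 1), fun _ => a, fun v => by simp only [NumTerm.val, interleave_odd]⟩

/-- Reindexing of variables. In the proof of an instance for a notion with arguments `t v`, the
terms `t` are applied to shifted sequences of variables below each quantifier. -/
instance (priority := low) ArithTerm.reindex (f : ℕ → ℕ) (t : (ℕ → N) → N) [ht : ArithTerm t] :
    ArithTerm (fun v => t (fun i => v (f i))) := by
  obtain ⟨τ, c, hτ⟩ := ht.exists_term
  refine ⟨τ.rename (interleave (fun i => 2 * f i) (fun i => 2 * i + 1)), c, fun v => ?_⟩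
  rw [NumTerm.val_rename, ← hτ]
  congr 1
  funext k
  refine forall_nat_parity (fun i => ?_) (fun i => ?_) k <;> simp

/-- Two terms can be given with the same parameters. -/
theorem ArithTerm.exists_pair (s t : (ℕ → N) → N) [hs : ArithTerm s] [ht : ArithTerm t] :
    ∃ (σ τ : NumTerm) (c : ℕ → N),
      (∀ v, σ.val (interleave v c) = s v) ∧ ∀ v, τ.val (interleave v c) = t v := by
  obtain ⟨σ, c, hσ⟩ := hs.exists_term
  obtain ⟨τ, d, hτ⟩ := ht.exists_term
  refine ⟨σ.rename (spreadParams 0), τ.rename (spreadParams 1), interleave c d, fun v => ?_,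
    fun v => ?_⟩
  · rw [NumTerm.val_rename, interleave_comp_spreadParams_zero, hσ]
  · rw [NumTerm.val_rename, interleave_comp_spreadParams_one, hτ]

instance ArithTerm.add (s t : (ℕ → N) → N) [ArithTerm s] [ArithTerm t] :
    ArithTerm (fun v => s v + t v) := by
  obtain ⟨σ, τ, c, hσ, hτ⟩ := ArithTerm.exists_pair s t
  exact ⟨.add σ τ, c, fun v => by simp [NumTerm.val, hσ, hτ]⟩

instance ArithTerm.mul (s t : (ℕ → N) → N) [ArithTerm s] [ArithTerm t] :
    ArithTerm (fun v => s v * t v) := by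
  obtain ⟨σ, τ, c, hσ, hτ⟩ := ArithTerm.exists_pair s t
  exact ⟨.mul σ τ, c, fun v => by simp [NumTerm.val, hσ, hτ]⟩

instance ArithTerm.pairCode (s t : (ℕ → N) → N) [ArithTerm s] [ArithTerm t] :
    ArithTerm (fun v => pairCode (s v) (t v)) := by
  unfold _root_.pairCode
  infer_instance

/-- `S` is a nonempty collection of sets; needed because formulas are evaluated with respect to
infinitely many set parameters. -/
class HasSets (S : Set (Set N)) : Prop where
  nonempty : S.Nonempty

variable {S : Set (Set N)}

instance ArithPred.eq [hS : HasSets S] (s t : (ℕ → N) → N) [ArithTerm s] [ArithTerm t] :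
    ArithPred S (fun v => s v = t v) := by
  obtain ⟨σ, τ, c, hσ, hτ⟩ := ArithTerm.exists_pair s t
  obtain ⟨X, hX⟩ := hS.nonempty
  exact ⟨.eq σ τ, c, fun _ => X, fun _ => hX, fun v => by simp [ArithFormula.Sat, hσ, hτ]⟩

instance ArithPred.lt [hS : HasSets S] (s t : (ℕ → N) → N) [ArithTerm s] [ArithTerm t] :
    ArithPred S (fun v => s v < t v) := by
  obtain ⟨σ, τ, c, hσ, hτ⟩ := ArithTerm.exists_pair s t
  obtain ⟨X, hX⟩ := hS.nonempty
  exact ⟨.lt σ τ, c, fun _ => X, fun _ => hX, fun v => by simp [ArithFormula.Sat, hσ, hτ]⟩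

instance ArithPred.mem (X : Set N) [hX : Fact (X ∈ S)] (t : (ℕ → N) → N) [ht : ArithTerm t] :
    ArithPred S (fun v => t v ∈ X) := by
  obtain ⟨τ, c, hτ⟩ := ht.exists_term
  exact ⟨.mem τ 0, c, fun _ => X, fun _ => hX.out, fun v => by simp [ArithFormula.Sat, hτ]⟩

instance ArithPred.not (P : (ℕ → N) → Prop) [hP : ArithPred S P] :
    ArithPred S (fun v => ¬ P v) := by
  obtain ⟨φ, c, E, hE, hφ⟩ := hP.exists_formula
  exact ⟨.neg φ, c, E, hE, fun v => by simp [ArithFormula.Sat, hφ]⟩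

instance ArithPred.and (P P' : (ℕ → N) → Prop) [hP : ArithPred S P] [hP' : ArithPred S P'] :
    ArithPred S (fun v => P v ∧ P' v) := by
  obtain ⟨φ, c, E, hE, hφ⟩ := hP.exists_formula
  obtain ⟨ψ, d, D, hD, hψ⟩ := hP'.exists_formula
  refine ⟨.and (φ.rename (spreadParams 0) (fun i => 2 * i))
    (ψ.rename (spreadParams 1) (fun i => 2 * i + 1)), interleave c d, interleave E D,
    forall_nat_parity (fun i => by simpa using hE i) (fun i => by simpa using hD i), fun v => ?_⟩
  have hE' : interleave E D ∘ (fun i => 2 * i) = E := by funext i; simp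
  have hD' : interleave E D ∘ (fun i => 2 * i + 1) = D := by funext i; simp
  simp only [ArithFormula.Sat, ArithFormula.sat_rename (spreadParams_injective _),
    interleave_comp_spreadParams_zero, interleave_comp_spreadParams_one, hE', hD', hφ, hψ]

instance ArithPred.all (P : (ℕ → N) → N → Prop)
    [hP : ArithPred S (fun v => P (fun i => v (i + 1)) (v 0))] :
    ArithPred S (fun v => ∀ a, P v a) := by
  obtain ⟨φ, c, E, hE, hφ⟩ := hP.exists_formula
  refine ⟨.all 1 (φ.rename bindFirst id), consSeq 0 c, E, hE, fun v => ?_⟩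
  simp only [ArithFormula.Sat, ArithFormula.sat_rename bindFirst_injective, update_comp_bindFirst,
    Function.comp_id, hφ, consSeq]

theorem ArithPred.congr {P P' : (ℕ → N) → Prop} (hP : ArithPred S P) (h : ∀ v, P v ↔ P' v) :
    ArithPred S P' :=
  (funext fun v => propext (h v) : P = P') ▸ hP

instance ArithPred.or (P P' : (ℕ → N) → Prop) [ArithPred S P] [ArithPred S P'] :
    ArithPred S (fun v => P v ∨ P' v) :=
  ArithPred.congr (P := fun v => ¬ (¬ P v ∧ ¬ P' v)) inferInstance fun v => by tauto

instance ArithPred.imp (P P' : (ℕ → N) → Prop) [ArithPred S P] [ArithPred S P'] :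
    ArithPred S (fun v => P v → P' v) :=
  ArithPred.congr (P := fun v => ¬ P v ∨ P' v) inferInstance fun v => by tauto

instance ArithPred.iff (P P' : (ℕ → N) → Prop) [ArithPred S P] [ArithPred S P'] :
    ArithPred S (fun v => P v ↔ P' v) :=
  ArithPred.congr (P := fun v => (P v → P' v) ∧ (P' v → P v)) inferInstance fun v => by tauto

instance ArithPred.ex (P : (ℕ → N) → N → Prop)
    [ArithPred S (fun v => P (fun i => v (i + 1)) (v 0))] :
    ArithPred S (fun v => ∃ a, P v a) :=
  ArithPred.congr (P := fun v => ¬ ∀ a, ¬ P v a) inferInstance fun v => by simp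

instance ArithPred.codeElem [HasSets S] (s t : (ℕ → N) → N) [ArithTerm s] [ArithTerm t] :
    ArithPred S (fun v => CodeElem (s v) (t v)) := by
  unfold CodeElem
  infer_instance

instance ArithPred.isFiniteCode [HasSets S] (s : (ℕ → N) → N) [ArithTerm s] :
    ArithPred S (fun v => IsFiniteCode (s v)) := by
  unfold IsFiniteCode
  infer_instance

instance ArithPred.strictlyBelow [HasSets S] (L : Set N) [Fact (L ∈ S)] (s t : (ℕ → N) → N)
    [ArithTerm s] [ArithTerm t] : ArithPred S (fun v => StrictlyBelow L (s v) (t v)) := by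
  unfold StrictlyBelow
  infer_instance

theorem ModelsACA0.hasSets (h : ModelsACA0 S) : HasSets S := ⟨h.sets_nonempty⟩

/-- Arithmetical comprehension for predicates in Lean's syntax. -/
theorem ModelsACA0.setOf_mem (h : ModelsACA0 S) (P : N → Prop)
    [hP : ArithPred S (fun v => P (v 0))] : {n | P n} ∈ S := by
  obtain ⟨φ, c, E, hE, hφ⟩ := hP.exists_formula
  convert h.comprehension φ (interleave (fun _ => 0) c) E hE with n
  have : Function.update (interleave (fun _ => 0) c) 0 n =
      interleave (fun i => if i = 0 then n else 0) c := by
    funext k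
    refine forall_nat_parity (fun i => ?_) (fun i => ?_) k
    · rcases i with _ | i <;> simp [Function.update, interleave]
    · simp [Function.update]
  rw [this, hφ]
  simp

/-- Induction for arithmetical predicates. -/
theorem ModelsACA0.arith_induction (h : ModelsACA0 S) (P : N → Prop)
    [ArithPred S (fun v => P (v 0))] (h0 : P 0) (hs : ∀ n, P n → P (n + 1)) (n : N) : P n :=
  h.induction _ (h.setOf_mem P) h0 hs n

end Definability

/-! ### Arithmetic in models of ACA₀ -/

section Arithmetic

variable {N : Type*} [ArithSignature N] {S : Set (Set N)}

namespace ModelsACA0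

theorem zero_add' (h : ModelsACA0 S) (n : N) : 0 + n = n := by
  have := h.hasSets
  exact h.arith_induction (fun n => 0 + n = n) (h.add_zero 0)
    (fun n ih => by rw [h.add_succ, ih]) n

theorem succ_add' (h : ModelsACA0 S) (m n : N) : m + 1 + n = m + n + 1 := by
  have := h.hasSets
  exact h.arith_induction (fun n => m + 1 + n = m + n + 1) (by rw [h.add_zero, h.add_zero])
    (fun n ih => by rw [h.add_succ, ih, h.add_succ]) n

theorem add_comm' (h : ModelsACA0 S) (m n : N) : m + n = n + m := by
  have := h.hasSets
  exact h.arith_induction (fun n => m + n = n + m) (by rw [h.add_zero, h.zero_add'])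
    (fun n ih => by rw [h.add_succ, ih, h.succ_add']) n

theorem add_assoc' (h : ModelsACA0 S) (k m n : N) : k + m + n = k + (m + n) := by
  have := h.hasSets
  exact h.arith_induction (fun n => k + m + n = k + (m + n)) (by rw [h.add_zero, h.add_zero])
    (fun n ih => by rw [h.add_succ, h.add_succ, h.add_succ, ih]) n

theorem zero_mul' (h : ModelsACA0 S) (n : N) : 0 * n = 0 := by
  have := h.hasSets
  exact h.arith_induction (fun n => 0 * n = 0) (h.mul_zero 0)
    (fun n ih => by rw [h.mul_succ, ih, h.add_zero]) n

theorem succ_mul' (h : ModelsACA0 S) (m n : N) : (m + 1) * n = m * n + n := by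
  have := h.hasSets
  refine h.arith_induction (fun n => (m + 1) * n = m * n + n)
    (by rw [h.mul_zero, h.mul_zero, h.add_zero]) (fun n ih => ?_) n
  rw [h.mul_succ, h.mul_succ, ih, h.add_assoc', h.add_assoc', h.add_succ, h.add_succ,
    h.add_comm' n m, h.add_succ m, h.add_succ]

theorem mul_comm' (h : ModelsACA0 S) (m n : N) : m * n = n * m := by
  have := h.hasSets
  exact h.arith_induction (fun n => m * n = n * m) (by rw [h.mul_zero, h.zero_mul'])
    (fun n ih => by rw [h.mul_succ, ih, h.succ_mul']) n

theorem mul_add' (h : ModelsACA0 S) (k m n : N) : k * (m + n) = k * m + k * n := by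
  have := h.hasSets
  exact h.arith_induction (fun n => k * (m + n) = k * m + k * n)
    (by rw [h.add_zero, h.mul_zero, h.add_zero])
    (fun n ih => by rw [h.add_succ, h.mul_succ, h.mul_succ, ih, h.add_assoc']) n

theorem mul_assoc' (h : ModelsACA0 S) (k m n : N) : k * m * n = k * (m * n) := by
  have := h.hasSets
  exact h.arith_induction (fun n => k * m * n = k * (m * n))
    (by rw [h.mul_zero, h.mul_zero, h.mul_zero])
    (fun n ih => by rw [h.mul_succ, h.mul_succ, ih, h.mul_add']) n

theorem mul_one' (h : ModelsACA0 S) (n : N) : n * 1 = n := by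
  have := h.mul_succ n 0
  rwa [h.zero_add', h.mul_zero, h.zero_add'] at this

/-- The numbers of a model of ACA₀ form a commutative semiring, with the given operations. -/
abbrev commSemiring (h : ModelsACA0 S) : CommSemiring N where
  add_assoc := h.add_assoc'
  zero_add := h.zero_add'
  add_zero := h.add_zero
  add_comm := h.add_comm'
  left_distrib := h.mul_add'
  right_distrib k m n := by rw [h.mul_comm', h.mul_add', h.mul_comm' n, h.mul_comm' n]
  zero_mul := h.zero_mul'
  mul_zero := h.mul_zero
  mul_assoc := h.mul_assoc'
  one_mul n := by rw [h.mul_comm', h.mul_one']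
  mul_one := h.mul_one'
  mul_comm := h.mul_comm'
  nsmul := nsmulRec

theorem add_right_cancel' (h : ModelsACA0 S) {m n : N} (k : N) : m + k = n + k → m = n := by
  have := h.hasSets
  refine h.arith_induction (fun k => m + k = n + k → m = n) (by simp [h.add_zero])
    (fun k ih hk => ih ?_) k
  rw [h.add_succ, h.add_succ] at hk
  exact h.succ_inj _ _ hk

theorem eq_zero_or_succ (h : ModelsACA0 S) (n : N) : n = 0 ∨ ∃ m, n = m + 1 := by
  have := h.hasSets
  exact h.arith_induction (fun n => n = 0 ∨ ∃ m, n = m + 1) (.inl rfl)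
    (fun n _ => .inr ⟨n, rfl⟩) n

theorem lt_iff_exists_add (h : ModelsACA0 S) (m n : N) : m < n ↔ ∃ d, n = m + (d + 1) := by
  have := h.hasSets
  refine h.arith_induction (fun n => m < n ↔ ∃ d, n = m + (d + 1)) ?_ (fun n ih => ?_) n
  · refine ⟨fun hm => (h.not_lt_zero m hm).elim, ?_⟩
    rintro ⟨d, hd⟩
    rw [h.add_succ] at hd
    exact (h.succ_ne_zero _ hd.symm).elim
  · rw [h.lt_succ, ih]
    constructor
    · rintro (⟨d, rfl⟩ | rfl)
      · exact ⟨d + 1, (h.add_succ _ _).symm⟩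
      · exact ⟨0, by rw [h.zero_add']⟩
    · rintro ⟨d, hd⟩
      rw [h.add_succ] at hd
      have hd := h.succ_inj _ _ hd
      rcases h.eq_zero_or_succ d with rfl | ⟨d, rfl⟩
      · exact .inr (by rw [hd, h.add_zero])
      · exact .inl ⟨d, hd⟩

theorem le_iff_exists_add' (h : ModelsACA0 S) (m n : N) : m < n ∨ m = n ↔ ∃ d, n = m + d := by
  rw [h.lt_iff_exists_add]
  constructor
  · rintro (⟨d, hd⟩ | rfl)
    exacts [⟨_, hd⟩, ⟨0, (h.add_zero m).symm⟩]
  · rintro ⟨d, rfl⟩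
    rcases h.eq_zero_or_succ d with rfl | ⟨d, rfl⟩
    exacts [.inr (h.add_zero m).symm, .inl ⟨d, rfl⟩]

theorem lt_irrefl' (h : ModelsACA0 S) (n : N) : ¬ n < n := by
  rw [h.lt_iff_exists_add]
  rintro ⟨d, hd⟩
  rw [h.add_comm'] at hd
  exact h.succ_ne_zero d (h.add_right_cancel' n (by rw [h.zero_add', ← hd]))

theorem lt_trans' (h : ModelsACA0 S) {k m n : N} (hkm : k < m) (hmn : m < n) : k < n := by
  rw [h.lt_iff_exists_add] at *
  obtain ⟨d, rfl⟩ := hkm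
  obtain ⟨e, rfl⟩ := hmn
  exact ⟨d + 1 + e, by rw [h.add_assoc', h.add_assoc' (d + 1)]⟩

theorem lt_trichotomy' (h : ModelsACA0 S) (m n : N) : m < n ∨ m = n ∨ n < m := by
  have := h.hasSets
  refine h.arith_induction (fun n => m < n ∨ m = n ∨ n < m) ?_ (fun n ih => ?_) n
  · exact .inr ((h.le_iff_exists_add' 0 m).2 ⟨m, (h.zero_add' m).symm⟩ |>.symm.imp_left Eq.symm)
  · rw [h.lt_succ]
    rcases ih with hm | rfl | hm
    · exact .inl (.inl hm)
    · exact .inl (.inr rfl)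
    · obtain ⟨d, rfl⟩ := (h.lt_iff_exists_add n m).1 hm
      refine .inr (((h.le_iff_exists_add' (n + 1) _).2 ⟨d, ?_⟩).symm.imp_left Eq.symm)
      rw [h.add_succ, h.succ_add']

open Classical in
/-- The numbers of a model of ACA₀ are linearly ordered by the given relation `<`. -/
noncomputable abbrev linearOrder (h : ModelsACA0 S) : LinearOrder N where
  le m n := m < n ∨ m = n
  le_refl _ := .inr rfl
  le_trans k m n := by
    rintro (hkm | rfl) (hmn | rfl)
    exacts [.inl (h.lt_trans' hkm hmn), .inl hkm, .inl hmn, .inr rfl]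
  lt_iff_le_not_ge m n := by
    constructor
    · intro hmn
      refine ⟨.inl hmn, ?_⟩
      rintro (hnm | rfl)
      exacts [h.lt_irrefl' _ (h.lt_trans' hmn hnm), h.lt_irrefl' _ hmn]
    · rintro ⟨hmn | rfl, hnm⟩
      exacts [hmn, (hnm (.inr rfl)).elim]
  le_antisymm m n := by
    rintro (hmn | rfl) (hnm | h')
    exacts [(h.lt_irrefl' _ (h.lt_trans' hmn hnm)).elim, h'.symm, rfl, rfl]
  le_total m n := by
    rcases h.lt_trichotomy' m n with h' | h' | h'
    exacts [.inl (.inl h'), .inl (.inr h'), .inr (.inl h')]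
  toDecidableLE := Classical.decRel _

theorem isStrictOrderedRing (h : ModelsACA0 S) :
    letI := h.commSemiring
    letI := h.linearOrder
    IsStrictOrderedRing N := by
  let := h.commSemiring
  let := h.linearOrder
  have hle (m n : N) : m ≤ n ↔ ∃ d, n = m + d := h.le_iff_exists_add' m n
  have hlt (m n : N) : m < n ↔ ∃ d, n = m + (d + 1) := h.lt_iff_exists_add m n
  have : IsOrderedCancelAddMonoid N :=
    { add_le_add_left := fun a b hab c => by
        obtain ⟨d, rfl⟩ := (hle _ _).1 hab
        exact (hle _ _).2 ⟨d, by ring⟩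
      le_of_add_le_add_left := fun a b c habc => by
        obtain ⟨d, hd⟩ := (hle _ _).1 habc
        refine (hle _ _).2 ⟨d, h.add_right_cancel' a ?_⟩
        rw [add_comm c, hd]
        ring }
  have hmul (a b c : N) (ha : 0 < a) (hbc : b < c) : a * b < a * c := by
    obtain ⟨d, rfl⟩ := (hlt _ _).1 ha
    obtain ⟨e, rfl⟩ := (hlt _ _).1 hbc
    exact (hlt _ _).2 ⟨d * e + d + e, by ring⟩
  exact
    { zero_le_one := (hle _ _).2 ⟨1, by ring⟩
      exists_pair_ne := ⟨0, 1, fun h01 => h.succ_ne_zero 0 (by rw [h.zero_add', ← h01])⟩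
      mul_lt_mul_of_pos_left := fun a ha b c hbc => hmul a b c ha hbc
      mul_lt_mul_of_pos_right := fun a ha b c hbc => by
        rw [mul_comm b, mul_comm c]
        exact hmul a b c ha hbc }

theorem canonicallyOrderedAdd (h : ModelsACA0 S) :
    letI := h.commSemiring
    letI := h.linearOrder
    CanonicallyOrderedAdd N := by
  let := h.commSemiring
  let := h.linearOrder
  have hle (m n : N) : m ≤ n ↔ ∃ d, n = m + d := h.le_iff_exists_add' m n
  exact
    { exists_add_of_le := fun {a b} hab => (hle a b).1 hab
      le_self_add := fun a b => (hle _ _).2 ⟨b, rfl⟩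
      le_add_self := fun a b => (hle _ _).2 ⟨b, add_comm _ _⟩ }

/-- The least number principle for arithmetical predicates. -/
theorem exists_least (h : ModelsACA0 S) (P : N → Prop) [ArithPred S (fun v => P (v 0))]
    (hP : ∃ n, P n) : ∃ n, P n ∧ ∀ m, m < n → ¬ P m := by
  have := h.hasSets
  by_contra! hno
  have key (n : N) : ∀ m, m < n → ¬ P m :=
    h.arith_induction (fun n => ∀ m, m < n → ¬ P m) (fun m hm => (h.not_lt_zero m hm).elim)
      (fun n ih m hm hPm => by
        obtain hm | rfl := (h.lt_succ m n).1 hm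
        · exact ih m hm hPm
        · obtain ⟨k, hk, hPk⟩ := hno m hPm
          exact ih k hk hPk) n
  obtain ⟨n, hn⟩ := hP
  exact key (n + 1) n ((h.lt_succ _ _).2 (.inr rfl)) hn

end ModelsACA0

section OrderedSemiring

variable {M : Type*} [CommSemiring M] [LinearOrder M] [IsStrictOrderedRing M]
  [CanonicallyOrderedAdd M]

/-- Injectivity of pairing. The square of `a + b` is the largest square below the code, which
determines `a + b`. -/
theorem square_add_injective (hM : ∀ x y : M, x < y → x + 1 ≤ y) {a b c d : M}
    (h : (a + b) * (a + b) + a = (c + d) * (c + d) + c) : a = c ∧ b = d := by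
  have aux {a b c d : M} (h : (a + b) * (a + b) + a = (c + d) * (c + d) + c) :
      ¬ a + b < c + d := fun hlt => by
    have h1 : (a + b + 1) * (a + b + 1) ≤ (c + d) * (c + d) :=
      mul_le_mul' (hM _ _ hlt) (hM _ _ hlt)
    have h2 : (a + b) * (a + b) + a < (a + b + 1) * (a + b + 1) := by
      have h3 : (a + b + 1) * (a + b + 1) = (a + b) * (a + b) + a + (a + 2 * b) + 1 := by ring
      rw [h3]
      exact lt_of_le_of_lt le_self_add (lt_add_one _)
    exact (h2.trans_le (h1.trans le_self_add)).ne h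
  have hab : a + b = c + d := le_antisymm (not_lt.1 (aux h.symm)) (not_lt.1 (aux h))
  rw [hab] at h
  obtain rfl := add_left_cancel h
  exact ⟨rfl, add_left_cancel hab⟩

theorem dvd_of_dvd_add {u a b : M} (ha : u ∣ a) (hab : u ∣ a + b) : u ∣ b := by
  obtain ⟨c, rfl⟩ := ha
  obtain ⟨d, hd⟩ := hab
  rcases le_total c d with hcd | hdc
  · obtain ⟨e, rfl⟩ := exists_add_of_le hcd
    rw [mul_add] at hd
    exact ⟨e, add_left_cancel hd⟩
  · obtain ⟨e, rfl⟩ := exists_add_of_le hdc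
    have : u * d + (u * e + b) = u * d + 0 := by rw [add_zero, ← add_assoc, ← mul_add, hd]
    have := add_left_cancel this
    rw [add_eq_zero] at this
    exact this.2 ▸ dvd_zero u

/-- The moduli `m * (x + 1) + 1` of the coding of finite sets are coprime when the differences of
the arguments divide `m`; coprimality is expressed as a cancellation rule. -/
theorem modulus_dvd_of_dvd_mul {m n x j d : M} (hd : d ∣ m) (hxj : x + d = j ∨ j + d = x)
    (h : m * (x + 1) + 1 ∣ n * (m * (j + 1) + 1)) : m * (x + 1) + 1 ∣ n := by
  obtain ⟨e, rfl⟩ := hd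
  set u := d * e * (x + 1) + 1 with hu
  -- The number `d` is a combination of the moduli for `x` and `j`, so it can be cancelled ...
  have hnd : u ∣ n * d := by
    rcases hxj with rfl | rfl
    · refine dvd_of_dvd_add (a := n * (d * e * (x + d + 1) + 1) * (x + 1)) (h.mul_right _) ?_
      exact ⟨n * (x + d + 1), by rw [hu]; ring⟩
    · refine dvd_of_dvd_add (a := n * u * (j + 1)) ((dvd_mul_left u n).mul_right _) ?_
      convert h.mul_right (j + d + 1) using 1
      rw [hu]; ring
  -- ... and `n * u - n` is a multiple of `n * d`.
  refine dvd_of_dvd_add (a := n * d * (e * (x + 1))) (hnd.mul_right _) ?_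
  exact ⟨n, by rw [hu]; ring⟩

end OrderedSemiring

namespace ModelsACA0

theorem add_one_le_of_lt' (h : ModelsACA0 S) (x y : N) (hxy : x < y) :
    x + 1 < y ∨ x + 1 = y := by
  obtain ⟨d, rfl⟩ := (h.lt_iff_exists_add x y).1 hxy
  exact (h.le_iff_exists_add' _ _).2 ⟨d, by rw [h.add_succ, h.succ_add']⟩

theorem pairCode_inj (h : ModelsACA0 S) {a b c d : N} :
    pairCode a b = pairCode c d ↔ a = c ∧ b = d := by
  let := h.commSemiring
  let := h.linearOrder
  have := h.isStrictOrderedRing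
  have := h.canonicallyOrderedAdd
  exact ⟨square_add_injective h.add_one_le_of_lt', fun ⟨h1, h2⟩ => by rw [h1, h2]⟩

/-- Elements of a coded finite set are smaller than the code. -/
theorem lt_of_codeElem (h : ModelsACA0 S) {x c : N} (hx : CodeElem x c) : x < c := by
  let := h.commSemiring
  let := h.linearOrder
  have := h.isStrictOrderedRing
  have := h.canonicallyOrderedAdd
  obtain ⟨k, m, n, rfl, hxk, -⟩ := hx
  exact hxk.trans_le (le_add_self : k ≤ (k + pairCode m n) * (k + pairCode m n) + k)

theorem not_codeElem_zero (h : ModelsACA0 S) (x : N) : ¬ CodeElem x 0 := fun hx =>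
  h.not_lt_zero x (h.lt_of_codeElem hx)

/-- For each `k` there is a positive number that all `d` with `0 < d ≤ k` divide. -/
theorem exists_common_multiple (h : ModelsACA0 S) (k : N) :
    ∃ m : N, m ≠ 0 ∧ ∀ d, d < k → ∃ e, m = (d + 1) * e := by
  have := h.hasSets
  refine h.arith_induction (fun k => ∃ m : N, m ≠ 0 ∧ ∀ d, d < k → ∃ e, m = (d + 1) * e)
    ⟨0 + 1, h.succ_ne_zero 0, fun d hd => (h.not_lt_zero d hd).elim⟩ ?_ k
  rintro k ⟨m, hm0, hm⟩
  refine ⟨(k + 1) * m, ?_, fun d hd => ?_⟩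
  · let := h.commSemiring
    let := h.linearOrder
    have := h.isStrictOrderedRing
    have := h.canonicallyOrderedAdd
    exact mul_ne_zero (h.succ_ne_zero k) hm0
  obtain hd | rfl := (h.lt_succ d k).1 hd
  · obtain ⟨e, rfl⟩ := hm d hd
    exact ⟨(k + 1) * e, by rw [← h.mul_assoc', ← h.mul_assoc', h.mul_comm' (k + 1)]⟩
  · exact ⟨m, rfl⟩

/-- Each bounded arithmetical collection of numbers has a code. -/
theorem exists_code (h : ModelsACA0 S) (P : N → Prop) [ArithPred S (fun v => P (v 0))] (k : N) :
    ∃ c : N, ∀ x, CodeElem x c ↔ P x ∧ x < k := by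
  have := h.hasSets
  have : Fact ({x | P x} ∈ S) := ⟨h.setOf_mem P⟩
  obtain ⟨m, hm0, hm⟩ := h.exists_common_multiple k
  -- The witness `n` is the product of the moduli for the elements below `j`.
  have key (j : N) : ¬ k < j → ∃ n : N, ∀ x, x < k →
      ((∃ d, n = (m * (x + 1) + 1) * d) ↔ x ∈ {x | P x} ∧ x < j) := by
    refine h.arith_induction (fun j => ¬ k < j → ∃ n : N, ∀ x, x < k →
      ((∃ d, n = (m * (x + 1) + 1) * d) ↔ x ∈ {x | P x} ∧ x < j)) ?_ ?_ j
    all_goals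
      let := h.commSemiring
      let := h.linearOrder
      have := h.isStrictOrderedRing
      have := h.canonicallyOrderedAdd
    · refine fun _ => ⟨1, fun x _ => iff_of_false ?_ fun hx => h.not_lt_zero x hx.2⟩
      rintro ⟨d, hd⟩
      have hd0 : d ≠ 0 := by
        rintro rfl
        rw [h.mul_zero] at hd
        exact one_ne_zero hd
      have hd1 : 1 ≤ d := by
        rw [← zero_add (1 : N)]
        exact h.add_one_le_of_lt' _ _ (pos_iff_ne_zero.2 hd0)
      have hu : 1 < m * (x + 1) + 1 := lt_add_of_pos_left 1
        (pos_iff_ne_zero.2 (mul_ne_zero hm0 (h.succ_ne_zero x)))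
      exact (hu.trans_le (le_mul_of_one_le_right' hd1)).ne hd
    · intro j ih hj
      have hjk : j < k := (lt_add_one j).trans_le (not_lt.1 hj)
      obtain ⟨n, hn⟩ := ih hjk.not_gt
      by_cases hjP : j ∈ {x | P x}
      · refine ⟨n * (m * (j + 1) + 1), fun x hx => ?_⟩
        rcases eq_or_ne x j with rfl | hxj
        · exact iff_of_true ⟨n, mul_comm _ _⟩ ⟨hjP, lt_add_one x⟩
        · have hxlt : x < j + 1 ↔ x < j := by rw [h.lt_succ]; simp [hxj]
          rw [hxlt, ← hn x hx]
          constructor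
          · intro hdvd
            -- The distance of `x` and `j` is positive and at most `k`, hence a divisor of `m`.
            have hdist : ∃ d, (x + (d + 1) = j ∨ j + (d + 1) = x) ∧ d < k := by
              rcases lt_or_gt_of_ne hxj with hlt | hlt
              · obtain ⟨d, rfl⟩ := (h.lt_iff_exists_add _ _).1 hlt
                exact ⟨d, .inl rfl, (lt_add_one d).trans_le (le_add_self.trans hjk.le)⟩
              · obtain ⟨d, rfl⟩ := (h.lt_iff_exists_add _ _).1 hlt
                exact ⟨d, .inr rfl, (lt_add_one d).trans_le (le_add_self.trans hx.le)⟩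
            obtain ⟨d, hd, hdk⟩ := hdist
            exact modulus_dvd_of_dvd_mul (hm d hdk) hd hdvd
          · rintro ⟨d, rfl⟩
            exact ⟨d * (m * (j + 1) + 1), mul_assoc _ _ _⟩
      · refine ⟨n, fun x hx => ?_⟩
        rw [hn x hx, h.lt_succ]
        exact ⟨fun hx => ⟨hx.1, .inl hx.2⟩, fun ⟨hxP, hx⟩ => ⟨hxP, hx.resolve_right
          fun hxj => hjP (hxj ▸ hxP)⟩⟩
  obtain ⟨n, hn⟩ := key k (h.lt_irrefl' k)
  refine ⟨pairCode k (pairCode m n), fun x => ?_⟩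
  constructor
  · rintro ⟨k', m', n', he, hxk, hdvd⟩
    obtain ⟨hk, he⟩ := h.pairCode_inj.1 he
    obtain ⟨hm, hn'⟩ := h.pairCode_inj.1 he
    rw [← hn', ← hm] at hdvd
    exact (hn x (hk ▸ hxk)).1 hdvd
  · exact fun hx => ⟨k, m, n, rfl, hx.2, (hn x hx.2).2 hx⟩

/-- Each bounded arithmetical collection of numbers has a canonical code. -/
theorem exists_isFiniteCode (h : ModelsACA0 S) (P : N → Prop) [ArithPred S (fun v => P (v 0))]
    (k : N) : ∃ c : N, IsFiniteCode c ∧ ∀ x, CodeElem x c ↔ P x ∧ x < k := by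
  have := h.hasSets
  have : Fact ({x | P x} ∈ S) := ⟨h.setOf_mem P⟩
  obtain ⟨c, hc, hmin⟩ := h.exists_least (fun c => ∀ x, CodeElem x c ↔ x ∈ {x | P x} ∧ x < k)
    (h.exists_code P k)
  exact ⟨c, fun c' hc' heq => hmin c' hc' fun x => (heq x).trans (hc x), hc⟩

theorem isFiniteCode_ext (h : ModelsACA0 S) {c d : N} (hc : IsFiniteCode c) (hd : IsFiniteCode d)
    (hcd : ∀ x, CodeElem x c ↔ CodeElem x d) : c = d := by
  rcases h.lt_trichotomy' c d with hlt | rfl | hlt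
  · exact (hd c hlt hcd).elim
  · rfl
  · exact (hc d hlt fun x => (hcd x).symm).elim

end ModelsACA0

end Arithmetic

/-! ### Blocks and arrays -/

section Arrays

variable {N : Type*} [ArithSignature N] {S : Set (Set N)}

/-- `a` is the least element of `X`. -/
def IsLeastElem (X : Set N) (a : N) : Prop := a ∈ X ∧ ∀ x ∈ X, ¬ x < a

/-- The finite set coded by `s` is an initial segment of the finite set coded by `t`. -/
def IsCodeInitialSegment (s t : N) : Prop :=
  ∃ n : N, ∀ x : N, CodeElem x s ↔ CodeElem x t ∧ x < n

instance ArithPred.isCodeInitialSegment [HasSets S] (s t : (ℕ → N) → N) [ArithTerm s]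
    [ArithTerm t] : ArithPred S (fun v => IsCodeInitialSegment (s v) (t v)) := by
  unfold IsCodeInitialSegment
  infer_instance

theorem IsInfiniteSubset.mono {V W X : Set N} (hX : IsInfiniteSubset S V X) (hVW : V ⊆ W) :
    IsInfiniteSubset S W X :=
  ⟨hX.1, hX.2.1.trans hVW, hX.2.2⟩

theorem IsInitialSegment.subset {s : N} {V X : Set N} (hs : IsInitialSegment s X)
    (hX : IsInfiniteSubset S V X) {x : N} (hx : CodeElem x s) : x ∈ V := by
  obtain ⟨n, hn⟩ := hs
  exact hX.2.1 ((hn x).1 hx).1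

theorem IsArray.exists_value {Q V F X : Set N} (hF : IsArray S Q V F)
    (hX : IsInfiniteSubset S V X) : ∃ q, ArrayValue F X q := by
  obtain ⟨-, -, B, -, hB, hFB⟩ := hF
  obtain ⟨s, ⟨hsB, hsX⟩, -⟩ := hB.2.2 X hX
  obtain ⟨q, hq, -⟩ := hFB.2 s hsB
  exact ⟨q, s, hsX, hq⟩

namespace ModelsACA0

theorem value_mem (h : ModelsACA0 S) {Q V F X : Set N} (hF : IsArray S Q V F) {q : N}
    (hq : ArrayValue F X q) : q ∈ Q := by
  obtain ⟨-, -, B, -, -, hFB⟩ := hF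
  obtain ⟨s, -, hs⟩ := hq
  obtain ⟨s', -, q', hq', he⟩ := hFB.1 _ hs
  rwa [(h.pairCode_inj.1 he).2]

theorem value_unique (h : ModelsACA0 S) {Q V F X : Set N} (hF : IsArray S Q V F)
    (hX : IsInfiniteSubset S V X) {p q : N} (hp : ArrayValue F X p) (hq : ArrayValue F X q) :
    p = q := by
  obtain ⟨-, -, B, -, hB, hFB⟩ := hF
  obtain ⟨s, hsX, hs⟩ := hp
  obtain ⟨t, htX, ht⟩ := hq
  have hmem {u r : N} (hu : pairCode u r ∈ F) : u ∈ B := by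
    obtain ⟨s', hs', q', -, he⟩ := hFB.1 _ hu
    rwa [(h.pairCode_inj.1 he).1]
  obtain rfl := (hB.2.2 X hX).unique ⟨hmem hs, hsX⟩ ⟨hmem ht, htX⟩
  exact (hFB.2 s (hmem hs)).unique hs ht

theorem isLeastElem_unique (h : ModelsACA0 S) {X : Set N} {a b : N} (ha : IsLeastElem X a)
    (hb : IsLeastElem X b) : a = b := by
  rcases h.lt_trichotomy' a b with hlt | rfl | hlt
  exacts [(hb.2 a ha.1 hlt).elim, rfl, (ha.2 b hb.1 hlt).elim]

theorem exists_isLeastElem (h : ModelsACA0 S) {V X : Set N} (hX : IsInfiniteSubset S V X) :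
    ∃ a, IsLeastElem X a := by
  have := h.hasSets
  have : Fact (X ∈ S) := ⟨hX.1⟩
  obtain ⟨x, hx, -⟩ := hX.2.2 0
  obtain ⟨a, ha, hmin⟩ := h.exists_least (fun a => a ∈ X) ⟨x, hx⟩
  exact ⟨a, ha, fun y hy hlt => hmin y hlt hy⟩

theorem removeMin_infinite (h : ModelsACA0 S) {V X : Set N} (hX : IsInfiniteSubset S V X) :
    IsInfiniteSubset S V (removeMin X) := by
  have := h.hasSets
  have : Fact (X ∈ S) := ⟨hX.1⟩
  refine ⟨h.setOf_mem _, fun x hx => hX.2.1 hx.1, fun n => ?_⟩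
  obtain ⟨x, hx, hnx⟩ := hX.2.2 n
  obtain ⟨y, hy, hxy⟩ := hX.2.2 x
  exact ⟨y, ⟨hy, x, hx, hxy⟩, h.lt_trans' hnx hxy⟩

theorem isCodeInitialSegment_refl (h : ModelsACA0 S) (s : N) : IsCodeInitialSegment s s :=
  ⟨s, fun _ => ⟨fun hx => ⟨hx, h.lt_of_codeElem hx⟩, fun hx => hx.1⟩⟩

/-- Two initial segments of a set are comparable. -/
theorem isCodeInitialSegment_total (h : ModelsACA0 S) {s t : N} {X : Set N}
    (hs : IsInitialSegment s X) (ht : IsInitialSegment t X) :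
    IsCodeInitialSegment s t ∨ IsCodeInitialSegment t s := by
  obtain ⟨m, hm⟩ := hs
  obtain ⟨n, hn⟩ := ht
  rcases h.lt_trichotomy' m n with hmn | rfl | hmn
  · refine .inl ⟨m, fun x => ?_⟩
    rw [hm, hn]
    exact ⟨fun hx => ⟨⟨hx.1, h.lt_trans' hx.2 hmn⟩, hx.2⟩, fun hx => ⟨hx.1.1, hx.2⟩⟩
  · refine .inl ⟨m, fun x => ?_⟩
    rw [hm, hn]
    tauto
  · refine .inr ⟨n, fun x => ?_⟩
    rw [hm, hn]
    exact ⟨fun hx => ⟨⟨hx.1, h.lt_trans' hx.2 hmn⟩, hx.2⟩, fun hx => ⟨hx.1.1, hx.2⟩⟩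

theorem isInitialSegment_trans (h : ModelsACA0 S) {s t : N} {X : Set N}
    (hst : IsCodeInitialSegment s t) (ht : IsInitialSegment t X) : IsInitialSegment s X := by
  obtain ⟨m, hm⟩ := hst
  obtain ⟨n, hn⟩ := ht
  rcases h.lt_trichotomy' m n with hmn | rfl | hmn
  · refine ⟨m, fun x => ?_⟩
    rw [hm, hn]
    exact ⟨fun hx => ⟨hx.1.1, hx.2⟩, fun hx => ⟨⟨hx.1, h.lt_trans' hx.2 hmn⟩, hx.2⟩⟩
  · refine ⟨m, fun x => ?_⟩
    rw [hm, hn]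
    tauto
  · refine ⟨n, fun x => ?_⟩
    rw [hm, hn]
    exact ⟨fun hx => hx.1, fun hx => ⟨hx, h.lt_trans' hx.2 hmn⟩⟩

theorem isCodeInitialSegment_antisymm (h : ModelsACA0 S) {s t : N} (hs : IsFiniteCode s)
    (ht : IsFiniteCode t) (hst : IsCodeInitialSegment s t) (hts : IsCodeInitialSegment t s) :
    s = t := by
  obtain ⟨m, hm⟩ := hst
  obtain ⟨n, hn⟩ := hts
  exact h.isFiniteCode_ext hs ht fun x =>
    ⟨fun hx => ((hm x).1 hx).1, fun hx => ((hn x).1 hx).1⟩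

/-- Two blocks have a common refinement on an infinite set `V` below their bases. It consists of
those elements of the two blocks that have initial segments in both, so that an infinite set
`X ⊆ V` gets the longer one of its two initial segments. -/
theorem exists_common_refinement (h : ModelsACA0 S) {V₁ V₂ V B₁ B₂ : Set N} (hB₁S : B₁ ∈ S)
    (hB₂S : B₂ ∈ S) (hB₁ : IsBlock S V₁ B₁) (hB₂ : IsBlock S V₂ B₂)
    (hV : IsInfiniteSubset S V V) (hV₁ : V ⊆ V₁) (hV₂ : V ⊆ V₂) :
    ∃ B ∈ S, IsBlock S V B ∧
      ∀ u ∈ B, (∃ s ∈ B₁, IsCodeInitialSegment s u) ∧ ∃ t ∈ B₂, IsCodeInitialSegment t u := by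
  have := h.hasSets
  have : Fact (V ∈ S) := ⟨hV.1⟩
  have : Fact (B₁ ∈ S) := ⟨hB₁S⟩
  have : Fact (B₂ ∈ S) := ⟨hB₂S⟩
  refine ⟨{u | (u ∈ B₁ ∨ u ∈ B₂) ∧ (∀ x, CodeElem x u → x ∈ V) ∧
    (∃ s ∈ B₁, IsCodeInitialSegment s u) ∧ ∃ t ∈ B₂, IsCodeInitialSegment t u}, h.setOf_mem _,
    ⟨hV, ?_, fun X hX => ?_⟩, fun u hu => hu.2.2⟩
  · rintro u ⟨hu | hu, huV, -⟩
    exacts [⟨(hB₁.2.1 u hu).1, (hB₁.2.1 u hu).2.1, huV⟩,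
      ⟨(hB₂.2.1 u hu).1, (hB₂.2.1 u hu).2.1, huV⟩]
  · obtain ⟨s, ⟨hs, hsX⟩, hsu⟩ := hB₁.2.2 X (hX.mono hV₁)
    obtain ⟨t, ⟨ht, htX⟩, htu⟩ := hB₂.2.2 X (hX.mono hV₂)
    have hmem {u : N} (hu : (u ∈ B₁ ∨ u ∈ B₂) ∧ (∀ x, CodeElem x u → x ∈ V) ∧
        (∃ s ∈ B₁, IsCodeInitialSegment s u) ∧ ∃ t ∈ B₂, IsCodeInitialSegment t u)
        (huX : IsInitialSegment u X) :
        (u = s ∨ u = t) ∧ IsCodeInitialSegment s u ∧ IsCodeInitialSegment t u := by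
      obtain ⟨hu, -, ⟨s', hs', hs'u⟩, t', ht', ht'u⟩ := hu
      obtain rfl := hsu s' ⟨hs', h.isInitialSegment_trans hs'u huX⟩
      obtain rfl := htu t' ⟨ht', h.isInitialSegment_trans ht'u huX⟩
      exact ⟨hu.imp (fun hu => hsu u ⟨hu, huX⟩) (fun hu => htu u ⟨hu, huX⟩), hs'u, ht'u⟩
    have hanti := h.isCodeInitialSegment_antisymm (hB₁.2.1 s hs).1 (hB₂.2.1 t ht).1
    refine existsUnique_of_exists_of_unique ?_ ?_
    · rcases h.isCodeInitialSegment_total hsX htX with hst | hts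
      · exact ⟨t, ⟨.inr ht, fun x hx => htX.subset hX hx, ⟨s, hs, hst⟩, t, ht,
          h.isCodeInitialSegment_refl t⟩, htX⟩
      · exact ⟨s, ⟨.inl hs, fun x hx => hsX.subset hX hx, ⟨s, hs,
          h.isCodeInitialSegment_refl s⟩, t, ht, hts⟩, hsX⟩
    · rintro u u' ⟨hu, huX⟩ ⟨hu', hu'X⟩
      obtain ⟨rfl | rfl, h1, h2⟩ := hmem hu huX <;>
        obtain ⟨rfl | rfl, h3, h4⟩ := hmem hu' hu'X
      exacts [rfl, hanti h3 h2, (hanti h1 h4).symm, rfl]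

/-- Arrays can be combined pointwise: if `H` is arithmetical and total, then there is an array
`K` on a given common subdomain with `H(F(X), G(X), K(X))` for all `X`. -/
theorem exists_combined_array (h : ModelsACA0 S) {Q₁ Q₂ Q V₁ V₂ V F G : Set N}
    (hF : IsArray S Q₁ V₁ F) (hG : IsArray S Q₂ V₂ G) (hV : IsInfiniteSubset S V V)
    (hV₁ : V ⊆ V₁) (hV₂ : V ⊆ V₂) (hQ : Q ∈ S) (H : N → N → N → Prop)
    (_ : ∀ (s t u : (ℕ → N) → N) [ArithTerm s] [ArithTerm t] [ArithTerm u],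
      ArithPred S (fun v => H (s v) (t v) (u v)))
    (hH : ∀ p ∈ Q₁, ∀ q ∈ Q₂, ∃ r ∈ Q, H p q r) :
    ∃ K, IsArray S Q V K ∧ ∀ X, IsInfiniteSubset S V X → ∀ r, ArrayValue K X r →
      ∃ p q, ArrayValue F X p ∧ ArrayValue G X q ∧ H p q r := by
  have := h.hasSets
  obtain ⟨-, hFS, B₁, hB₁S, hB₁, hFB⟩ := hF
  obtain ⟨-, hGS, B₂, hB₂S, hB₂, hGB⟩ := hG
  obtain ⟨B, hBS, hB, hB₁₂⟩ := h.exists_common_refinement hB₁S hB₂S hB₁ hB₂ hV hV₁ hV₂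
  have : Fact (F ∈ S) := ⟨hFS⟩
  have : Fact (G ∈ S) := ⟨hGS⟩
  have : Fact (B ∈ S) := ⟨hBS⟩
  have : Fact (Q ∈ S) := ⟨hQ⟩
  -- `W` relates an element of the block to all admissible values; `K` picks the least one.
  obtain ⟨W, hWS, hW⟩ : ∃ W ∈ S, ∀ u r, pairCode u r ∈ W ↔ r ∈ Q ∧ ∃ s p t q,
      IsCodeInitialSegment s u ∧ pairCode s p ∈ F ∧ IsCodeInitialSegment t u ∧
      pairCode t q ∈ G ∧ H p q r := by
    refine ⟨{k | ∃ u r, k = pairCode u r ∧ r ∈ Q ∧ ∃ s p t q, IsCodeInitialSegment s u ∧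
      pairCode s p ∈ F ∧ IsCodeInitialSegment t u ∧ pairCode t q ∈ G ∧ H p q r},
      h.setOf_mem _, fun u r => ⟨?_, fun hur => ⟨u, r, rfl, hur⟩⟩⟩
    rintro ⟨u', r', he, hur⟩
    obtain ⟨rfl, rfl⟩ := h.pairCode_inj.1 he
    exact hur
  have : Fact (W ∈ S) := ⟨hWS⟩
  have hK (u r : N) : pairCode u r ∈ {k | ∃ u r, k = pairCode u r ∧ u ∈ B ∧ pairCode u r ∈ W ∧
      ∀ r', r' < r → ¬ pairCode u r' ∈ W} ↔
      u ∈ B ∧ pairCode u r ∈ W ∧ ∀ r', r' < r → ¬ pairCode u r' ∈ W := by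
    refine ⟨?_, fun hur => ⟨u, r, rfl, hur⟩⟩
    rintro ⟨u', r', he, hur⟩
    obtain ⟨rfl, rfl⟩ := h.pairCode_inj.1 he
    exact hur
  refine ⟨{k | ∃ u r, k = pairCode u r ∧ u ∈ B ∧ pairCode u r ∈ W ∧
    ∀ r', r' < r → ¬ pairCode u r' ∈ W}, ⟨hV.1, h.setOf_mem _, B, hBS, hB, ?_, fun u hu => ?_⟩,
    ?_⟩
  · rintro _ ⟨u, r, rfl, hu, hur, -⟩
    exact ⟨u, hu, r, ((hW u r).1 hur).1, rfl⟩
  · refine existsUnique_of_exists_of_unique ?_ fun r r' hr hr' => ?_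
    · obtain ⟨⟨s, hs, hsu⟩, t, ht, htu⟩ := hB₁₂ u hu
      obtain ⟨p, hp, -⟩ := hFB.2 s hs
      obtain ⟨q, hq, -⟩ := hGB.2 t ht
      obtain ⟨s', -, p', hp', he⟩ := hFB.1 _ hp
      obtain ⟨t', -, q', hq', he'⟩ := hGB.1 _ hq
      obtain ⟨r, hr, hpqr⟩ := hH p ((h.pairCode_inj.1 he).2 ▸ hp') q
        ((h.pairCode_inj.1 he').2 ▸ hq')
      obtain ⟨r, hr, hmin⟩ := h.exists_least (fun r => pairCode u r ∈ W)
        ⟨r, (hW u r).2 ⟨hr, s, p, t, q, hsu, hp, htu, hq, hpqr⟩⟩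
      exact ⟨r, (hK u r).2 ⟨hu, hr, hmin⟩⟩
    · rw [hK] at hr hr'
      rcases h.lt_trichotomy' r r' with hlt | rfl | hlt
      exacts [(hr'.2.2 r hlt hr.2.1).elim, rfl, (hr.2.2 r' hlt hr'.2.1).elim]
  · rintro X hX r ⟨u, huX, hur⟩
    obtain ⟨-, s, p, t, q, hsu, hp, htu, hq, hpqr⟩ := (hW u r).1 ((hK u r).1 hur).2.1
    exact ⟨p, q, ⟨s, h.isInitialSegment_trans hsu huX, hp⟩,
      ⟨t, h.isInitialSegment_trans htu huX, hq⟩, hpqr⟩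

/-- The array on `[V]^ω` whose value at `X` is the pair of the first two elements of `X`; its block
consists of the two-element subsets of `V`. -/
theorem exists_pair_array (h : ModelsACA0 S) {V : Set N} (hV : IsInfiniteSubset S V V) :
    ∃ P, IsArray S {l | ∃ a b, a < b ∧ l = pairCode a b} V P ∧ ∀ X, IsInfiniteSubset S V X →
      ∀ l, ArrayValue P X l →
        ∃ a b, l = pairCode a b ∧ IsLeastElem X a ∧ IsLeastElem (removeMin X) b := by
  have := h.hasSets
  have : Fact (V ∈ S) := ⟨hV.1⟩
  -- Two-element initial segments list the first two elements.
  have hfirst {s a b : N} {X : Set N} (hs : ∀ x, CodeElem x s ↔ x = a ∨ x = b) (hab : a < b)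
      (hsX : IsInitialSegment s X) : IsLeastElem X a ∧ IsLeastElem (removeMin X) b := by
    obtain ⟨n, hn⟩ := hsX
    have ha := (hn a).1 ((hs a).2 (.inl rfl))
    have hb := (hn b).1 ((hs b).2 (.inr rfl))
    have hX {x : N} (hx : x ∈ X) (hxb : x < b) : x = a := by
      have := (hs x).1 ((hn x).2 ⟨hx, h.lt_trans' hxb hb.2⟩)
      exact this.resolve_right fun hxb' => h.lt_irrefl' x (hxb'.symm ▸ hxb)
    refine ⟨⟨ha.1, fun x hx hxa => ?_⟩, ⟨hb.1, a, ha.1, hab⟩, ?_⟩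
    · have := hX hx (h.lt_trans' hxa hab)
      exact h.lt_irrefl' a (this ▸ hxa)
    · rintro x ⟨hx, y, hy, hyx⟩ hxb
      obtain rfl := hX hx hxb
      obtain rfl := hX hy (h.lt_trans' hyx hxb)
      exact h.lt_irrefl' _ hyx
  have hsecond {a b a' b' s : N} (hs : ∀ x, CodeElem x s ↔ x = a ∨ x = b) (hab : a < b)
      (hs' : ∀ x, CodeElem x s ↔ x = a' ∨ x = b') (hab' : a' < b') : a = a' ∧ b = b' := by
    have hself : IsInitialSegment s {x | CodeElem x s} := h.isCodeInitialSegment_refl s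
    obtain ⟨h1, h2⟩ := hfirst hs hab hself
    obtain ⟨h3, h4⟩ := hfirst hs' hab' hself
    exact ⟨h.isLeastElem_unique h1 h3, h.isLeastElem_unique h2 h4⟩
  refine ⟨{k | ∃ s a b, k = pairCode s (pairCode a b) ∧ IsFiniteCode s ∧ a < b ∧ a ∈ V ∧ b ∈ V ∧
    ∀ x, CodeElem x s ↔ x = a ∨ x = b}, ⟨hV.1, h.setOf_mem _,
    {s | ∃ a b, IsFiniteCode s ∧ a < b ∧ a ∈ V ∧ b ∈ V ∧ ∀ x, CodeElem x s ↔ x = a ∨ x = b},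
    h.setOf_mem _, ⟨hV, ?_, fun X hX => existsUnique_of_exists_of_unique ?_ ?_⟩, ?_,
    fun s hs => existsUnique_of_exists_of_unique ?_ ?_⟩, ?_⟩
  · rintro s ⟨a, b, hs, -, ha, hb, hsab⟩
    refine ⟨hs, ⟨a, (hsab a).2 (.inl rfl)⟩, fun x hx => ?_⟩
    rcases (hsab x).1 hx with rfl | rfl
    exacts [ha, hb]
  · obtain ⟨a, ha⟩ := h.exists_isLeastElem hX
    obtain ⟨b, hb⟩ := h.exists_isLeastElem (h.removeMin_infinite hX)
    have hab : a < b := by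
      obtain ⟨y, hy, hyb⟩ := hb.1.2
      rcases h.lt_trichotomy' a y with hay | rfl | hay
      exacts [h.lt_trans' hay hyb, hyb, (ha.2 y hy hay).elim]
    obtain ⟨s, hs, hsab⟩ := h.exists_isFiniteCode (fun x => x = a ∨ x = b) (b + 1)
    have hsab' (x : N) : CodeElem x s ↔ x = a ∨ x = b := by
      rw [hsab, and_iff_left_iff_imp, h.lt_succ]
      rintro (rfl | rfl)
      exacts [.inl hab, .inr rfl]
    refine ⟨s, ⟨a, b, hs, hab, hX.2.1 ha.1, hX.2.1 hb.1.1, hsab'⟩, b + 1, fun x => ?_⟩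
    rw [hsab', h.lt_succ]
    constructor
    · rintro (rfl | rfl)
      exacts [⟨ha.1, .inl hab⟩, ⟨hb.1.1, .inr rfl⟩]
    · rintro ⟨hx, hxb | rfl⟩
      · rcases h.lt_trichotomy' a x with hax | rfl | hax
        exacts [(hb.2 x ⟨hx, a, ha.1, hax⟩ hxb).elim, .inl rfl, (ha.2 x hx hax).elim]
      · exact .inr rfl
  · rintro s s' ⟨⟨a, b, hs, hab, -, -, hsab⟩, hsX⟩ ⟨⟨a', b', hs', hab', -, -, hsab'⟩, hs'X⟩
    obtain ⟨h1, h2⟩ := hfirst hsab hab hsX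
    obtain ⟨h3, h4⟩ := hfirst hsab' hab' hs'X
    obtain rfl := h.isLeastElem_unique h1 h3
    obtain rfl := h.isLeastElem_unique h2 h4
    exact h.isFiniteCode_ext hs hs' fun x => (hsab x).trans (hsab' x).symm
  · rintro _ ⟨s, a, b, rfl, hs⟩
    exact ⟨s, ⟨a, b, hs⟩, _, ⟨a, b, hs.2.1, rfl⟩, rfl⟩
  · obtain ⟨a, b, hs⟩ := hs
    exact ⟨_, s, a, b, rfl, hs⟩
  · rintro l l' ⟨s₁, a, b, he, -, hab, -, -, hsab⟩ ⟨s₂, a', b', he', -, hab', -, -, hsab'⟩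
    obtain ⟨rfl, rfl⟩ := h.pairCode_inj.1 he
    obtain ⟨rfl, rfl⟩ := h.pairCode_inj.1 he'
    obtain ⟨rfl, rfl⟩ := hsecond hsab hab hsab' hab'
    rfl
  · rintro X - l ⟨s, hsX, s₁, a, b, he, -, hab, -, -, hsab⟩
    obtain ⟨rfl, rfl⟩ := h.pairCode_inj.1 he
    exact ⟨a, b, rfl, hfirst hsab hab hsX⟩

end ModelsACA0

end Arrays

/-! ### Tagged elements and the reduction to quasi orders -/

section Reduction

variable {N : Type*} [ArithSignature N] {S : Set (Set N)}

/-- The number that codes a quadruple: an element `p` together with a label `(a, b)` and the (code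
of the) finite set `E` of earlier values. -/
def tagged (a b E p : N) : N := pairCode (pairCode a b) (pairCode E p)

instance ArithTerm.tagged (s t u w : (ℕ → N) → N) [ArithTerm s] [ArithTerm t] [ArithTerm u]
    [ArithTerm w] : ArithTerm (fun v => tagged (s v) (t v) (u v) (w v)) := by
  unfold _root_.tagged
  infer_instance

theorem ModelsACA0.tagged_inj (h : ModelsACA0 S) {a b E p a' b' E' p' : N} :
    tagged a b E p = tagged a' b' E' p' ↔ a = a' ∧ b = b' ∧ E = E' ∧ p = p' := by
  simp only [tagged, h.pairCode_inj, and_assoc]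

/-- The set of tagged elements of `Q`. -/
def taggedSet (Q : Set N) : Set N := {x | ∃ a b E p, x = tagged a b E p ∧ a < b ∧ p ∈ Q}

/-- `(a, b, E, p) <' (c, d, E', q)` in the ranking of tagged elements: the labels agree, `p` lies
below `q`, and `E` contains both `q` and the earlier values in `E'`. -/
def TaggedBelow (L : Set N) (a b E p c d E' q : N) : Prop :=
  a = c ∧ b = d ∧ StrictlyBelow L p q ∧ CodeElem q E ∧ ∀ e, CodeElem e E' → CodeElem e E

/-- The partial ranking of tagged elements. -/
def taggedRanking (Q L : Set N) : Set N :=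
  {k | ∃ a b E p c d E' q, k = pairCode (tagged a b E p) (tagged c d E' q) ∧
    (a < b ∧ p ∈ Q) ∧ (c < d ∧ q ∈ Q) ∧
    (tagged a b E p = tagged c d E' q ∨ TaggedBelow L a b E p c d E' q)}

/-- The quasi order on tagged elements. It extends the ranking. When the label of the
second element starts where the label of the first element ends, the current value `p` or some
earlier value in `E` has to be `R`-related to `q`; when it starts later, there is no condition, which makes the relation transitive even though `R` may not be. -/
def taggedOrder (Q R L : Set N) : Set N :=
  {k | ∃ a b E p c d E' q, k = pairCode (tagged a b E p) (tagged c d E' q) ∧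
    (a < b ∧ p ∈ Q) ∧ (c < d ∧ q ∈ Q) ∧
    ((tagged a b E p = tagged c d E' q ∨ TaggedBelow L a b E p c d E' q) ∨
      (b = c ∧ ∃ e, (CodeElem e E ∨ e = p) ∧ pairCode e q ∈ R) ∨ b < c)}

namespace ModelsACA0

theorem mem_taggedSet (h : ModelsACA0 S) {Q : Set N} {a b E p : N} :
    tagged a b E p ∈ taggedSet Q ↔ a < b ∧ p ∈ Q := by
  constructor
  · rintro ⟨a', b', E', p', he, hp⟩
    obtain ⟨rfl, rfl, rfl, rfl⟩ := h.tagged_inj.1 he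
    exact hp
  · exact fun hp => ⟨a, b, E, p, rfl, hp⟩

theorem mem_taggedRanking (h : ModelsACA0 S) {Q L : Set N} {a b E p c d E' q : N} :
    pairCode (tagged a b E p) (tagged c d E' q) ∈ taggedRanking Q L ↔
      (a < b ∧ p ∈ Q) ∧ (c < d ∧ q ∈ Q) ∧
        (tagged a b E p = tagged c d E' q ∨ TaggedBelow L a b E p c d E' q) := by
  constructor
  · rintro ⟨_, _, _, _, _, _, _, _, he, hp⟩
    obtain ⟨h1, h2⟩ := h.pairCode_inj.1 he
    obtain ⟨rfl, rfl, rfl, rfl⟩ := h.tagged_inj.1 h1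
    obtain ⟨rfl, rfl, rfl, rfl⟩ := h.tagged_inj.1 h2
    exact hp
  · exact fun hp => ⟨a, b, E, p, c, d, E', q, rfl, hp⟩

theorem mem_taggedOrder (h : ModelsACA0 S) {Q R L : Set N} {a b E p c d E' q : N} :
    pairCode (tagged a b E p) (tagged c d E' q) ∈ taggedOrder Q R L ↔
      (a < b ∧ p ∈ Q) ∧ (c < d ∧ q ∈ Q) ∧
        ((tagged a b E p = tagged c d E' q ∨ TaggedBelow L a b E p c d E' q) ∨
          (b = c ∧ ∃ e, (CodeElem e E ∨ e = p) ∧ pairCode e q ∈ R) ∨ b < c) := by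
  constructor
  · rintro ⟨_, _, _, _, _, _, _, _, he, hp⟩
    obtain ⟨h1, h2⟩ := h.pairCode_inj.1 he
    obtain ⟨rfl, rfl, rfl, rfl⟩ := h.tagged_inj.1 h1
    obtain ⟨rfl, rfl, rfl, rfl⟩ := h.tagged_inj.1 h2
    exact hp
  · exact fun hp => ⟨a, b, E, p, c, d, E', q, rfl, hp⟩

theorem taggedSet_mem (h : ModelsACA0 S) {Q : Set N} (hQ : Q ∈ S) : taggedSet Q ∈ S := by
  have := h.hasSets
  have : Fact (Q ∈ S) := ⟨hQ⟩
  exact h.setOf_mem _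

theorem taggedRanking_mem (h : ModelsACA0 S) {Q L : Set N} (hQ : Q ∈ S) (hL : L ∈ S) :
    taggedRanking Q L ∈ S := by
  have := h.hasSets
  have : Fact (Q ∈ S) := ⟨hQ⟩
  have : Fact (L ∈ S) := ⟨hL⟩
  unfold taggedRanking TaggedBelow
  exact h.setOf_mem _

theorem taggedOrder_mem (h : ModelsACA0 S) {Q R L : Set N} (hQ : Q ∈ S) (hR : R ∈ S) (hL : L ∈ S) :
    taggedOrder Q R L ∈ S := by
  have := h.hasSets
  have : Fact (Q ∈ S) := ⟨hQ⟩
  have : Fact (R ∈ S) := ⟨hR⟩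
  have : Fact (L ∈ S) := ⟨hL⟩
  unfold taggedOrder TaggedBelow
  exact h.setOf_mem _

theorem strictlyBelow_trans {Q L : Set N} (hL : IsPartialOrderOn Q L) {p q r : N}
    (hpq : StrictlyBelow L p q) (hqr : StrictlyBelow L q r) : StrictlyBelow L p r := by
  refine ⟨hL.2.2.1 p q r hpq.1 hqr.1, ?_⟩
  rintro rfl
  exact hpq.2 (hL.2.2.2 p q hpq.1 hqr.1)

theorem taggedBelow_trans {Q L : Set N} (hL : IsPartialOrderOn Q L)
    {a b E p c d E' q g k E'' r : N} (h1 : TaggedBelow L a b E p c d E' q)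
    (h2 : TaggedBelow L c d E' q g k E'' r) : TaggedBelow L a b E p g k E'' r := by
  obtain ⟨rfl, rfl, hpq, -, hE⟩ := h1
  obtain ⟨rfl, rfl, hqr, hr, hE'⟩ := h2
  exact ⟨rfl, rfl, strictlyBelow_trans hL hpq hqr, hE _ hr, fun e he => hE e (hE' e he)⟩

theorem taggedRanking_isPartialOrderOn (h : ModelsACA0 S) {Q L : Set N}
    (hL : IsPartialOrderOn Q L) : IsPartialOrderOn (taggedSet Q) (taggedRanking Q L) := by
  refine ⟨?_, ?_, ?_, ?_⟩
  · rintro _ ⟨a, b, E, p, c, d, E', q, rfl, hp, hq, -⟩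
    exact ⟨_, h.mem_taggedSet.2 hp, _, h.mem_taggedSet.2 hq, rfl⟩
  · rintro _ ⟨a, b, E, p, rfl, hp⟩
    exact h.mem_taggedRanking.2 ⟨hp, hp, .inl rfl⟩
  · rintro x y z ⟨a, b, E, p, c, d, E', q, he, hp, hq, h1⟩
      ⟨c', d', E₁, q', g, k, E'', r, he', -, hr, h2⟩
    obtain ⟨rfl, rfl⟩ := h.pairCode_inj.1 he
    obtain ⟨hy, rfl⟩ := h.pairCode_inj.1 he'
    obtain ⟨rfl, rfl, rfl, rfl⟩ := h.tagged_inj.1 hy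
    refine h.mem_taggedRanking.2 ⟨hp, hr, ?_⟩
    rcases h1 with h1 | h1
    · obtain ⟨rfl, rfl, rfl, rfl⟩ := h.tagged_inj.1 h1
      exact h2
    · rcases h2 with h2 | h2
      · obtain ⟨rfl, rfl, rfl, rfl⟩ := h.tagged_inj.1 h2
        exact .inr h1
      · exact .inr (taggedBelow_trans hL h1 h2)
  · rintro x y ⟨a, b, E, p, c, d, E', q, he, hp, hq, h1⟩ hyx
    obtain ⟨rfl, rfl⟩ := h.pairCode_inj.1 he
    obtain ⟨-, -, h2⟩ := h.mem_taggedRanking.1 hyx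
    rcases h1 with h1 | h1
    · exact h1
    rcases h2 with h2 | h2
    · exact h2.symm
    exact ((taggedBelow_trans hL h1 h2).2.2.1.2 rfl).elim

theorem taggedRanking_isWellFoundedOn (h : ModelsACA0 S) {Q L : Set N}
    (hL : IsWellFoundedOn S Q L) : IsWellFoundedOn S (taggedSet Q) (taggedRanking Q L) := by
  intro Z hZ hZQ hne
  have := h.hasSets
  have : Fact (Z ∈ S) := ⟨hZ⟩
  -- A tagged element with `L`-minimal underlying value is minimal.
  obtain ⟨m, ⟨a, b, E, hm⟩, hmin⟩ := hL {p | ∃ a b E, tagged a b E p ∈ Z} (h.setOf_mem _)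
    (by
      rintro p ⟨a, b, E, hp⟩
      exact (h.mem_taggedSet.1 (hZQ hp)).2)
    (by
      obtain ⟨z, hz⟩ := hne
      obtain ⟨a, b, E, p, rfl, -⟩ := hZQ hz
      exact ⟨p, a, b, E, hz⟩)
  refine ⟨_, hm, fun z hz hlt => ?_⟩
  obtain ⟨c, d, E', q, rfl, -⟩ := hZQ hz
  obtain ⟨-, -, h1⟩ := h.mem_taggedRanking.1 hlt.1
  exact hmin q ⟨c, d, E', hz⟩ (h1.resolve_left hlt.2).2.2.1

theorem taggedOrder_isQuasiOrderOn (h : ModelsACA0 S) {Q R L : Set N}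
    (hL : IsPartialRanking S Q R L) : IsQuasiOrderOn (taggedSet Q) (taggedOrder Q R L) := by
  refine ⟨?_, ?_, ?_⟩
  · rintro _ ⟨a, b, E, p, c, d, E', q, rfl, hp, hq, -⟩
    exact ⟨_, h.mem_taggedSet.2 hp, _, h.mem_taggedSet.2 hq, rfl⟩
  · rintro _ ⟨a, b, E, p, rfl, hp⟩
    exact h.mem_taggedOrder.2 ⟨hp, hp, .inl (.inl rfl)⟩
  · rintro x y z ⟨a, b, E, p, c, d, E', q, he, hp, hq, h1⟩
      ⟨c', d', E₁, q', g, k, E'', r, he', -, hr, h2⟩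
    obtain ⟨rfl, rfl⟩ := h.pairCode_inj.1 he
    obtain ⟨hy, rfl⟩ := h.pairCode_inj.1 he'
    obtain ⟨rfl, rfl, rfl, rfl⟩ := h.tagged_inj.1 hy
    refine h.mem_taggedOrder.2 ⟨hp, hr, ?_⟩
    rcases h1 with (h1 | h1) | h1
    · obtain ⟨rfl, rfl, rfl, rfl⟩ := h.tagged_inj.1 h1
      exact h2
    · rcases h2 with (h2 | h2) | h2
      · obtain ⟨rfl, rfl, rfl, rfl⟩ := h.tagged_inj.1 h2
        exact .inl (.inr h1)
      · exact .inl (.inr (taggedBelow_trans hL.1 h1 h2))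
      · -- The set `E` contains `q` and `E'`, so a witness for `y` and `z` also serves `x` and `z`.
        obtain ⟨rfl, rfl, -, hqE, hE⟩ := h1
        refine .inr (h2.imp_left ?_)
        rintro ⟨rfl, e, he | rfl, her⟩
        exacts [⟨rfl, e, .inl (hE e he), her⟩, ⟨rfl, e, .inl hqE, her⟩]
    · rcases h2 with (h2 | h2) | h2
      · obtain ⟨rfl, rfl, rfl, rfl⟩ := h.tagged_inj.1 h2
        exact .inr h1
      · obtain ⟨rfl, rfl, hqr, -⟩ := h2
        refine .inr (h1.imp_left ?_)
        rintro ⟨rfl, e, he, heq⟩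
        exact ⟨rfl, e, he, hL.2.2 e q r heq hqr.1⟩
      · -- Now `b ≤ c < d ≤ g`.
        have hbd : b < d := by
          rcases h1 with ⟨rfl, -⟩ | h1
          exacts [hq.1, h.lt_trans' h1 hq.1]
        refine .inr (.inr ?_)
        rcases h2 with ⟨rfl, -⟩ | h2
        exacts [hbd, h.lt_trans' hbd h2]

theorem taggedRanking_isPartialRanking (h : ModelsACA0 S) {Q R L : Set N}
    (hL : IsPartialRanking S Q R L) :
    IsPartialRanking S (taggedSet Q) (taggedOrder Q R L) (taggedRanking Q L) := by
  refine ⟨h.taggedRanking_isPartialOrderOn hL.1, h.taggedRanking_isWellFoundedOn hL.2.1,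
    fun x y z hxy hyz => (h.taggedOrder_isQuasiOrderOn hL).2.2 x y z hxy ?_⟩
  obtain ⟨a, b, E, p, c, d, E', q, he, hp, hq, h1⟩ := hyz
  rw [he]
  exact h.mem_taggedOrder.2 ⟨hp, hq, .inl h1⟩

/-- For successive labels, the quasi order of tagged elements depends on `R` only. -/
theorem mem_taggedOrder_successive (h : ModelsACA0 S) {Q R L : Set N} {a b E p d E' q : N} :
    pairCode (tagged a b E p) (tagged b d E' q) ∈ taggedOrder Q R L ↔
      (a < b ∧ p ∈ Q) ∧ (b < d ∧ q ∈ Q) ∧ ∃ e, (CodeElem e E ∨ e = p) ∧ pairCode e q ∈ R := by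
  rw [h.mem_taggedOrder]
  refine and_congr_right fun hp => and_congr_right fun _ => ⟨?_, fun he => .inr (.inl ⟨rfl, he⟩)⟩
  have hab : a ≠ b := by
    rintro rfl
    exact h.lt_irrefl' a hp.1
  rintro ((h1 | h1) | ⟨-, he⟩ | h1)
  exacts [(hab (h.tagged_inj.1 h1).1).elim, (hab h1.1).elim, he, (h.lt_irrefl' b h1).elim]

end ModelsACA0

/-- The value of an array of tagged elements at `X` is labelled by the first two elements
of `X`. -/
def HasFirstTwoLabels (S : Set (Set N)) (V F : Set N) : Prop :=
  ∀ X, IsInfiniteSubset S V X → ∀ x, ArrayValue F X x →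
    ∃ a b E p, x = tagged a b E p ∧ IsLeastElem X a ∧ IsLeastElem (removeMin X) b

namespace ModelsACA0

theorem successive_labels (h : ModelsACA0 S) {V F X : Set N} (hF : HasFirstTwoLabels S V F)
    (hX : IsInfiniteSubset S V X) {x y : N} (hx : ArrayValue F X x)
    (hy : ArrayValue F (removeMin X) y) :
    ∃ a b E p d E' q, x = tagged a b E p ∧ y = tagged b d E' q := by
  obtain ⟨a, b, E, p, rfl, -, hb⟩ := hF X hX x hx
  obtain ⟨b', d, E', q, rfl, hb', -⟩ := hF _ (h.removeMin_infinite hX) y hy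
  obtain rfl := h.isLeastElem_unique hb hb'
  exact ⟨a, b, E, p, d, E', q, rfl, rfl⟩

/-- An `R`-bad array becomes a bad array of tagged elements when each value is labelled with
the first two elements of the argument. -/
theorem exists_tagged_array (h : ModelsACA0 S) {Q R L V F : Set N} (hQ : Q ∈ S)
    (hF : IsBadArray S Q R V F) : ∃ G, IsBadArray S (taggedSet Q) (taggedOrder Q R L) V G ∧
      HasFirstTwoLabels S V G := by
  have := h.hasSets
  obtain ⟨hF, hbad⟩ := hF
  have hV : IsInfiniteSubset S V V := by
    obtain ⟨-, -, B, -, hB, -⟩ := hF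
    exact hB.1
  obtain ⟨P, hP, hPval⟩ := h.exists_pair_array hV
  obtain ⟨G, hG, hGval⟩ := h.exists_combined_array hF hP hV subset_rfl subset_rfl
    (h.taggedSet_mem hQ) (fun p l x => ∃ a b, l = pairCode a b ∧ x = tagged a b 0 p)
    (fun _ _ _ _ _ _ => inferInstance) (by
      rintro p hp _ ⟨a, b, hab, rfl⟩
      exact ⟨_, h.mem_taggedSet.2 ⟨hab, hp⟩, a, b, rfl, rfl⟩)
  have hval {X : Set N} (hX : IsInfiniteSubset S V X) {x : N} (hx : ArrayValue G X x) :
      ∃ a b p, x = tagged a b 0 p ∧ ArrayValue F X p ∧ IsLeastElem X a ∧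
        IsLeastElem (removeMin X) b := by
    obtain ⟨p, l, hp, hl, a, b, rfl, rfl⟩ := hGval X hX x hx
    obtain ⟨a', b', he, hab⟩ := hPval X hX _ hl
    obtain ⟨rfl, rfl⟩ := h.pairCode_inj.1 he
    exact ⟨a, b, p, rfl, hp, hab⟩
  have hlab : HasFirstTwoLabels S V G := fun X hX x hx => by
    obtain ⟨a, b, p, rfl, -, hab⟩ := hval hX hx
    exact ⟨a, b, 0, p, rfl, hab⟩
  refine ⟨G, ⟨hG, ?_⟩, hlab⟩
  rintro ⟨X, hX, x, y, hx, hy, hxy⟩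
  obtain ⟨a, b, E, p, d, E', q, rfl, rfl⟩ := h.successive_labels hlab hX hx hy
  obtain ⟨_, _, p', he, hp, -⟩ := hval hX hx
  obtain ⟨rfl, rfl, rfl, rfl⟩ := h.tagged_inj.1 he
  obtain ⟨_, _, q', he', hq, -⟩ := hval (h.removeMin_infinite hX) hy
  obtain ⟨-, rfl, rfl, rfl⟩ := h.tagged_inj.1 he'
  obtain ⟨-, -, e, he | rfl, heq⟩ := h.mem_taggedOrder_successive.1 hxy
  exacts [h.not_codeElem_zero e he, hbad ⟨X, hX, e, q, hp, hq, heq⟩]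

/-- The quasi-order version of the minimal bad array lemma, applied to tagged elements, yields
a minimal `R`-bad array as soon as there is an `R`-bad array. -/
theorem exists_isMinimalBadArray (h : ModelsACA0 S) (hMBA : SimpsonMinimalBadArrayLemma S)
    {Q R L V₀ F₀ : Set N} (hQ : Q ∈ S) (hR : R ∈ S) (hL : L ∈ S)
    (hrank : IsPartialRanking S Q R L) (hF₀ : IsBadArray S Q R V₀ F₀) :
    ∃ V F : Set N, IsMinimalBadArray S Q R L V F := by
  have := h.hasSets
  obtain ⟨G₀, hG₀, hlab₀⟩ := h.exists_tagged_array (L := L) hQ hF₀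
  obtain ⟨V, G, ⟨⟨hG, hGbad⟩, hmin⟩, hVV₀, hle⟩ := hMBA _ (h.taggedSet_mem hQ) _
    (h.taggedOrder_mem hQ hR hL) _ (h.taggedRanking_mem hQ hL) (h.taggedOrder_isQuasiOrderOn hrank)
    (h.taggedRanking_isPartialRanking hrank) _ _ hG₀
  have hV : IsInfiniteSubset S V V := by
    obtain ⟨-, -, B, -, hB, -⟩ := hG
    exact hB.1
  -- The ranking only compares elements with the same label, so `G` inherits its labels.
  have hlab : HasFirstTwoLabels S V G := fun X hX x hx => by
    obtain ⟨y, hy⟩ := hG₀.1.exists_value (hX.mono hVV₀)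
    obtain ⟨a, b, E, p, c, d, E', q, he, -, -, hxy⟩ := hle X hX x y hx hy
    obtain ⟨rfl, rfl⟩ := h.pairCode_inj.1 he
    obtain ⟨c', d', E'', q', he, hcd⟩ := hlab₀ X (hX.mono hVV₀) _ hy
    obtain ⟨rfl, rfl, -, -⟩ := h.tagged_inj.1 he
    have hac : a = c ∧ b = d := by
      rcases hxy with hxy | hxy
      exacts [⟨(h.tagged_inj.1 hxy).1, (h.tagged_inj.1 hxy).2.1⟩, ⟨hxy.1, hxy.2.1⟩]
    obtain ⟨rfl, rfl⟩ := hac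
    exact ⟨a, b, E, p, rfl, hcd⟩
  obtain ⟨F, hF, hFval⟩ := h.exists_combined_array hG hG hV subset_rfl subset_rfl hQ
    (fun x _ p => ∃ a b E, x = tagged a b E p) (fun _ _ _ _ _ _ => inferInstance) (by
      rintro _ ⟨a, b, E, p, rfl, -, hp⟩ - -
      exact ⟨p, hp, a, b, E, rfl⟩)
  have hval {X : Set N} (hX : IsInfiniteSubset S V X) {p : N} (hp : ArrayValue F X p) :
      ∃ a b E, ArrayValue G X (tagged a b E p) := by
    obtain ⟨_, -, hx, -, a, b, E, rfl⟩ := hFval X hX p hp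
    exact ⟨a, b, E, hx⟩
  refine ⟨V, F, ⟨hF, ?_⟩, ?_⟩
  · rintro ⟨X, hX, p, q, hp, hq, hpq⟩
    obtain ⟨a, b, E, hx⟩ := hval hX hp
    obtain ⟨b', d, E', hy⟩ := hval (h.removeMin_infinite hX) hq
    obtain ⟨_, _, _, _, _, _, _, he, he'⟩ := h.successive_labels hlab hX hx hy
    obtain ⟨rfl, rfl, rfl, rfl⟩ := h.tagged_inj.1 he
    obtain ⟨rfl, rfl, rfl, rfl⟩ := h.tagged_inj.1 he'
    exact hGbad ⟨X, hX, _, _, hx, hy, h.mem_taggedOrder_successive.2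
      ⟨h.mem_taggedSet.1 (h.value_mem hG hx), h.mem_taggedSet.1 (h.value_mem hG hy), p, .inr rfl,
        hpq⟩⟩
  · rintro ⟨V₁, F₁, ⟨hF₁, hbad₁⟩, hV₁V, hlt⟩
    have hV₁ : IsInfiniteSubset S V₁ V₁ := by
      obtain ⟨-, -, B, -, hB, -⟩ := hF₁
      exact hB.1
    -- A smaller bad array `F₁` takes over the labels of `G`; the old values are remembered.
    obtain ⟨G₁, hG₁, hG₁val⟩ := h.exists_combined_array hG hF₁ hV₁ hV₁V subset_rfl
      (h.taggedSet_mem hQ) (fun x q y => ∃ a b E p E', x = tagged a b E p ∧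
        y = tagged a b E' q ∧ ∀ e, CodeElem e E' ↔ CodeElem e E ∨ e = p)
      (fun _ _ _ _ _ _ => inferInstance) (by
        rintro _ ⟨a, b, E, p, rfl, hab, hp⟩ q hq
        obtain ⟨m, hEm, hpm⟩ : ∃ m, (∀ e, CodeElem e E → e < m) ∧ p < m := by
          rcases h.lt_trichotomy' E p with hlt | rfl | hlt
          · exact ⟨p + 1, fun e he => (h.lt_succ _ _).2 (.inl (h.lt_trans' (h.lt_of_codeElem he)
              hlt)), (h.lt_succ _ _).2 (.inr rfl)⟩
          · exact ⟨E + 1, fun e he => (h.lt_succ _ _).2 (.inl (h.lt_of_codeElem he)),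
              (h.lt_succ _ _).2 (.inr rfl)⟩
          · exact ⟨E, fun e he => h.lt_of_codeElem he, hlt⟩
        obtain ⟨E', hE'⟩ := h.exists_code (fun e => CodeElem e E ∨ e = p) m
        refine ⟨_, h.mem_taggedSet.2 ⟨hab, hq⟩, a, b, E, p, E', rfl, rfl, fun e => ?_⟩
        rw [hE', and_iff_left_iff_imp]
        rintro (he | rfl)
        exacts [hEm e he, hpm])
    have hval₁ {X : Set N} (hX : IsInfiniteSubset S V₁ X) {y : N} (hy : ArrayValue G₁ X y) :
        ∃ a b E p E' q, y = tagged a b E' q ∧ ArrayValue G X (tagged a b E p) ∧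
          ArrayValue F₁ X q ∧ StrictlyBelow L q p ∧ ∀ e, CodeElem e E' ↔ CodeElem e E ∨ e = p := by
      obtain ⟨_, q, hx, hq, a, b, E, p, E', rfl, rfl, hE'⟩ := hG₁val X hX y hy
      obtain ⟨p', hp'⟩ := hF.exists_value (hX.mono hV₁V)
      obtain ⟨a', b', E'', hx'⟩ := hval (hX.mono hV₁V) hp'
      obtain ⟨-, -, -, rfl⟩ := h.tagged_inj.1 (h.value_unique hG (hX.mono hV₁V) hx hx')
      exact ⟨a, b, E, p, E', q, rfl, hx, hq, hlt X hX q p hq hp', hE'⟩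
    refine hmin ⟨V₁, G₁, ⟨hG₁, ?_⟩, hV₁V, fun X hX y x hy hx => ?_⟩
    · rintro ⟨X, hX, y, y', hy, hy', hyy'⟩
      have hXm := h.removeMin_infinite hX
      obtain ⟨a, b, E, p, E₁, q, rfl, hGX, hFX, -, hE₁⟩ := hval₁ hX hy
      obtain ⟨c, d, E', p', E₁', q', rfl, hGX', hFX', hlt', -⟩ := hval₁ hXm hy'
      obtain ⟨_, _, _, _, _, _, _, he, he'⟩ :=
        h.successive_labels hlab (hX.mono hV₁V) hGX hGX'
      obtain ⟨rfl, rfl, rfl, rfl⟩ := h.tagged_inj.1 he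
      obtain ⟨rfl, rfl, rfl, rfl⟩ := h.tagged_inj.1 he'
      obtain ⟨-, -, e, he | rfl, heq⟩ := h.mem_taggedOrder_successive.1 hyy'
      · -- An old value `e` with `e R q'` and `q' ≤' p'` contradicts the badness of `G`.
        exact hGbad ⟨X, hX.mono hV₁V, _, _, hGX, hGX', h.mem_taggedOrder_successive.2
          ⟨h.mem_taggedSet.1 (h.value_mem hG hGX), h.mem_taggedSet.1 (h.value_mem hG hGX'), e,
            (hE₁ e).1 he, hrank.2.2 e q' p' heq hlt'.1⟩⟩
      · exact hbad₁ ⟨X, hX, e, q', hFX, hFX', heq⟩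
    · obtain ⟨a, b, E, p, E₁, q, rfl, hGX, -, hqp, hE₁⟩ := hval₁ hX hy
      obtain rfl := h.value_unique hG (hX.mono hV₁V) hGX hx
      refine ⟨h.mem_taggedRanking.2 ⟨h.mem_taggedSet.1 (h.value_mem hG₁ hy),
        h.mem_taggedSet.1 (h.value_mem hG hGX), .inr ⟨rfl, rfl, hqp, (hE₁ p).2 (.inr rfl),
          fun e he => (hE₁ e).2 (.inl he)⟩⟩, fun he => hqp.2 (h.tagged_inj.1 he).2.2.2⟩

end ModelsACA0

end Reduction

/-- Over ATR₀ (that is, in every model `(N, S)` of ATR₀), Simpson's minimal bad array lemma for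
quasi orders implies its analogue for reflexive relations. -/
theorem corollary2p3 {N : Type*} [ArithSignature N] (S : Set (Set N)) (hATR : ModelsATR0 S)
    (hMBA : SimpsonMinimalBadArrayLemma S)
    (Q R L : Set N) (hQ : Q ∈ S) (hR : R ∈ S) (hL : L ∈ S)
    (hRQ : IsRelationOn Q R) (hrefl : IsReflexiveOn Q R)
    (hrank : IsPartialRanking S Q R L) (hbad : ¬ IsBetterRelation S Q R) :
    ∃ V F : Set N, IsMinimalBadArray S Q R L V F := by
  obtain ⟨V₀, F₀, hF₀⟩ := not_not.1 hbad
  exact hATR.toModelsACA0.exists_isMinimalBadArray hMBA hQ hR hL hrank hF₀
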